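/- Let $p$ be an odd prime and let $\varphi:\mathrm{GL}_2(\mathbb{Z}/p^2\mathbb{Z})\to \mathrm{GL}_2(\mathbb{Z}/p\mathbb{Z})$ be the natural homomorphism. For $k \ge 1$ let $C_s(p^k)$ be the subgroup of all diagonal matrices in $\mathrm{GL}_2(\mathbb{Z}/p^k\mathbb{Z})$. Two subgroups $H_1,H_2$ of a group $G$ are called *locally conjugate in $G$* if there is a bijection $f:H_1\to H_2$ such that $h$ and $f(h)$ are conjugate in $G$ for every $h\in H_1$; they are *nontrivially locally conjugate in $G$* if they are locally conjugate in $G$ but not conjugate in $G$. Two subgroups $D,D'\le C_s(p^2)$ are called *diagonal swaps* if $\begin{pmatrix} w&0\\0&z\end{pmatrix}\in D$ exactly when $\begin{pmatrix} z&0\\0&w\end{pmatrix}\in D'$. Let $H_1,H_2\le \mathrm{GL}_2(\mathbb{Z}/p^2\mathbb{Z})$ with $\varphi(H_1)\le C_s(p)$ and $\varphi(H_2)\le C_s(p)$. Then $H_1$ and $H_2$ are nontrivially locally conjugate in $\mathrm{GL}_2(\mathbb{Z}/p^2\mathbb{Z})$ if and only if there are subgroups $D,D'\le C_s(p^2)$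 with $D\ne D'$ that are diagonal swaps, such that $H_1$ and $H_2$ are, in some order, conjugate in $\mathrm{GL}_2(\mathbb{Z}/p^2\mathbb{Z})$ to $$\left\langle D,\ I+\begin{pmatrix}0&1\\0&0\end{pmatrix}p\right\rangle \quad\text{and}\quad \left\langle D',\ I+\begin{pmatrix}0&1\\0&0\end{pmatrix}p\right\rangle .$$ (The two conjugations are allowed to be by different elements.) -/

import Mathlib

open scoped MatrixGroups

/-- Two subgroups `H₁`, `H₂` of a group `G` are locally conjugate in `G` if there is a bijection
`H₁ → H₂` under which corresponding elements are conjugate in `G`. -/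
def LocallyConjugate {G : Type*} [Group G] (H₁ H₂ : Subgroup G) : Prop :=
  ∃ f : H₁ ≃ H₂, ∀ h : H₁, IsConj (h : G) (f h : G)

/-- Two subgroups `H₁`, `H₂` of `G` are conjugate in `G` if `H₂ = g H₁ g⁻¹` for some `g : G`. -/
def ConjugateSubgroups {G : Type*} [Group G] (H₁ H₂ : Subgroup G) : Prop :=
  ∃ g : G, H₁.map (MulAut.conj g).toMonoidHom = H₂

/-- Locally conjugate in `G`, but not conjugate in `G`. -/
def NontriviallyLocallyConjugate {G : Type*} [Group G] (H₁ H₂ : Subgroup G) : Prop :=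
  LocallyConjugate H₁ H₂ ∧ ¬ ConjugateSubgroups H₁ H₂

/-- The Cartan-split subgroup: the invertible diagonal `2 × 2` matrices. -/
def cartanSplit (R : Type*) [CommRing R] : Subgroup (GL (Fin 2) R) where
  carrier := {g | ∃ w z : R, (g : Matrix (Fin 2) (Fin 2) R) = !![w, 0; 0, z]}
  one_mem' := ⟨1, 1, by simp [Matrix.one_fin_two]⟩
  mul_mem' := by
    rintro a b ⟨w, z, h⟩ ⟨w', z', h'⟩
    exact ⟨w * w', z * z', by simp [h, h']⟩
  inv_mem' := by
    rintro a ⟨w, z, h⟩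
    refine ⟨Ring.inverse (w * z) * z, Ring.inverse (w * z) * w, ?_⟩
    rw [Matrix.coe_units_inv, Matrix.inv_def, h, Matrix.adjugate_fin_two_of, Matrix.det_fin_two_of]
    simp

/-- Two subgroups `D₁`, `D₂` consisting of diagonal matrices are diagonal swaps if
`diag(w, z) ∈ D₁` exactly when `diag(z, w) ∈ D₂`. -/
def DiagonalSwaps {R : Type*} [CommRing R] (D₁ D₂ : Subgroup (GL (Fin 2) R)) : Prop :=
  D₁ ≤ cartanSplit R ∧ D₂ ≤ cartanSplit R ∧
    ∀ w z : R,
      (∃ g ∈ D₁, (g : Matrix (Fin 2) (Fin 2) R) = !![w, 0; 0, z]) ↔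
        (∃ g ∈ D₂, (g : Matrix (Fin 2) (Fin 2) R) = !![z, 0; 0, w])

/-- The natural homomorphism `GL₂(ℤ/p²ℤ) → GL₂(ℤ/pℤ)`, reduction of the entries modulo `p`. -/
def reductionModP (p : ℕ) : GL (Fin 2) (ZMod (p ^ 2)) →* GL (Fin 2) (ZMod p) :=
  Matrix.GeneralLinearGroup.map (ZMod.castHom (dvd_pow_self p two_ne_zero) (ZMod p))

/-- The element `I + (0 1; 0 0) p` of `GL₂(ℤ/p²ℤ)`. -/
def onePlusE12p (p : ℕ) : GL (Fin 2) (ZMod (p ^ 2)) where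
  val := 1 + (p : ZMod (p ^ 2)) • !![0, 1; 0, 0]
  inv := 1 - (p : ZMod (p ^ 2)) • !![0, 1; 0, 0]
  val_inv := by simp [Matrix.one_fin_two]
  inv_val := by simp [Matrix.one_fin_two]

/-- The subgroup `⟨D, I + (0 1; 0 0) p⟩` of `GL₂(ℤ/p²ℤ)`. -/
def adjoinOnePlusE12p (p : ℕ) (D : Subgroup (GL (Fin 2) (ZMod (p ^ 2)))) :
    Subgroup (GL (Fin 2) (ZMod (p ^ 2))) :=
  Subgroup.closure ((D : Set (GL (Fin 2) (ZMod (p ^ 2)))) ∪ {onePlusE12p p})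

/-!
Write `R = ℤ/p²ℤ` and `K = ℤ/pℤ`. The kernel of reduction `GL₂(R) → GL₂(K)` consists of the matrices
`1 + p A` with `A` a matrix over `K`, so a subgroup `H` of `GL₂(R)` has a kernel part: the space
`kernelSub H` of those `A` with `1 + p A ∈ H`. Local conjugacy of subgroups restricts to local
conjugacy of the kernel parts. The core of the proof is `LocallyConjugate.conjugate_or_exceptional`:
locally conjugate subgroups that are diagonal modulo `p` are conjugate, or are up to conjugacy two
groups of upper triangular matrices containing `1 + p E₁₂`, with swapped diagonal parts.

*Linear algebra.* Locally conjugate subspaces of `M₂(K)` are conjugate, except for the planes spanned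
by `E₁₂` and a diagonal matrix, where the diagonal entries may be swapped
(`LocConjSub.conjSub_or_exceptionalSub`). Local conjugacy passes to orthogonal complements for the
trace form (`LocConjSub.perp`), because the Fourier transform of the indicator function of a subspace
is a multiple of that of its complement while class functions are preserved. This leaves lines, which
are immediate, and planes. The relevant planes share a traceless matrix `A` and contain a matrix `B`
of trace `1`; if `A` is invertible a Skolem–Noether argument applies, and if `A` is nilpotent
the planes can be listed.

*Scalar modulo `p`.* If all elements of `H` are scalar modulo `p`, then `H` is the product of its
scalar matrices and its kernel elements, since `p`-th powers are scalar. The scalar matrices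
are determined by local conjugacy, and the linear algebra decides
(`LocallyConjugate.conjugate_or_exceptional_of_scalar`).

*Not scalar modulo `p`.* Otherwise `H` can be conjugated to contain a diagonal matrix with entries
distinct modulo `p`. It then contains the diagonal factor of each of its elements
(`IsFramed.diagGL_mem`), so it is described by its diagonal matrices and by the antidiagonal part of
its kernel. The diagonal matrices agree for the two groups up to a swap
(`LocallyConjugate.forall_diagGL_mem_iff_or`): a group covered by three subgroups, one of which is
proper, either lies in one of the other two or has a Klein four quotient, and the latter is excluded
as `p` is odd. Two antidiagonal lines spanned by `(a, b)` and `(a', b')` satisfy `a b = t² a' b'` with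
`t ≠ 0` (`exists_sq_of_locConjSub`), so they are conjugate by a diagonal matrix or are coordinate
lines; different coordinate lines give an exceptional pair.

Conversely, reflection in the antidiagonal is a local conjugacy between the groups attached to two
diagonal swaps (`isConj_antiTranspose`), and a matrix conjugating one of them onto the other is upper
triangular modulo `p`, which forces equal diagonal parts (`le_of_conjugateSubgroups_adjoin`).
-/

/-! ### Conjugation of `2 × 2` matrices over a field -/

section LinearAlgebra

variable {K : Type*} [Field K]

/-- Conjugation `X ↦ g X g⁻¹` by an invertible matrix, as a linear automorphism of the space of
`2 × 2` matrices. -/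
def conjMap (g : GL (Fin 2) K) : Matrix (Fin 2) (Fin 2) K ≃ₗ[K] Matrix (Fin 2) (Fin 2) K where
  toFun X := g * X * (g⁻¹ : GL (Fin 2) K)
  invFun X := (g⁻¹ : GL (Fin 2) K) * X * g
  map_add' X Y := by simp only [mul_add, add_mul]
  map_smul' c X := by simp
  left_inv X := by
    simp only [← mul_assoc, Units.inv_mul, one_mul]
    rw [mul_assoc, Units.inv_mul, mul_one]
  right_inv X := by
    simp only [← mul_assoc, Units.mul_inv, one_mul]
    rw [mul_assoc, Units.mul_inv, mul_one]

theorem conjMap_apply (g : GL (Fin 2) K) (X : Matrix (Fin 2) (Fin 2) K) :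
    conjMap g X = g * X * (g⁻¹ : GL (Fin 2) K) := rfl

theorem conjMap_eq_iff {g : GL (Fin 2) K} {X Y : Matrix (Fin 2) (Fin 2) K} :
    conjMap g X = Y ↔ (g : Matrix (Fin 2) (Fin 2) K) * X = Y * g := by
  rw [conjMap_apply, Units.mul_inv_eq_iff_eq_mul]

theorem conjMap_mul (g h : GL (Fin 2) K) (X : Matrix (Fin 2) (Fin 2) K) :
    conjMap (g * h) X = conjMap g (conjMap h X) := by
  simp [conjMap_apply, mul_assoc]

theorem conjMap_inv_conjMap (g : GL (Fin 2) K) (X : Matrix (Fin 2) (Fin 2) K) :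
    conjMap g⁻¹ (conjMap g X) = X := by
  rw [← conjMap_mul]
  simp [conjMap_apply]

@[simp] theorem conjMap_one (g : GL (Fin 2) K) : conjMap g 1 = 1 := by simp [conjMap_apply]

theorem trace_conjMap (g : GL (Fin 2) K) (X : Matrix (Fin 2) (Fin 2) K) :
    (conjMap g X).trace = X.trace := by
  rw [conjMap_apply, Matrix.trace_mul_comm, ← mul_assoc]
  simp

theorem det_conjMap (g : GL (Fin 2) K) (X : Matrix (Fin 2) (Fin 2) K) :
    (conjMap g X).det = X.det := by
  rw [conjMap_apply, Matrix.det_mul, Matrix.det_mul, mul_comm, ← mul_assoc, ← Matrix.det_mul]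
  simp

theorem conjMap_mul_mul (g : GL (Fin 2) K) (X Y : Matrix (Fin 2) (Fin 2) K) :
    conjMap g (X * Y) = conjMap g X * conjMap g Y := by
  simp [conjMap_apply, mul_assoc]

/-- Two matrices are similar if some invertible matrix conjugates the first to the second. -/
def MatConj (X Y : Matrix (Fin 2) (Fin 2) K) : Prop := ∃ g : GL (Fin 2) K, conjMap g X = Y

theorem MatConj.symm {X Y : Matrix (Fin 2) (Fin 2) K} (h : MatConj X Y) : MatConj Y X := by
  obtain ⟨g, rfl⟩ := h
  exact ⟨g⁻¹, conjMap_inv_conjMap g X⟩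

theorem MatConj.trans {X Y Z : Matrix (Fin 2) (Fin 2) K} (h : MatConj X Y) (h' : MatConj Y Z) :
    MatConj X Z := by
  obtain ⟨g, rfl⟩ := h
  obtain ⟨g', rfl⟩ := h'
  exact ⟨g' * g, conjMap_mul g' g X⟩

theorem MatConj.trace_eq {X Y : Matrix (Fin 2) (Fin 2) K} (h : MatConj X Y) :
    Y.trace = X.trace := by
  obtain ⟨g, rfl⟩ := h
  exact trace_conjMap g X

theorem MatConj.det_eq {X Y : Matrix (Fin 2) (Fin 2) K} (h : MatConj X Y) : Y.det = X.det := by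
  obtain ⟨g, rfl⟩ := h
  exact det_conjMap g X

theorem MatConj.eq_zero_iff {X Y : Matrix (Fin 2) (Fin 2) K} (h : MatConj X Y) :
    Y = 0 ↔ X = 0 := by
  obtain ⟨g, rfl⟩ := h
  simp

theorem MatConj.eq_one {Y : Matrix (Fin 2) (Fin 2) K} (h : MatConj 1 Y) : Y = 1 := by
  obtain ⟨g, rfl⟩ := h
  simp

/-- Similarity of matrices as a setoid. -/
def matConjSetoid (K : Type*) [Field K] : Setoid (Matrix (Fin 2) (Fin 2) K) where
  r := MatConj
  iseqv := ⟨fun X => ⟨1, by simp [conjMap_apply]⟩, MatConj.symm, MatConj.trans⟩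

/-- Two subspaces of `2 × 2` matrices are locally conjugate if some bijection (not assumed to be
linear) sends every matrix to a similar one. -/
def LocConjSub (V W : Submodule K (Matrix (Fin 2) (Fin 2) K)) : Prop :=
  ∃ f : V ≃ W, ∀ v : V, MatConj (v : Matrix (Fin 2) (Fin 2) K) (f v)

/-- Two subspaces of `2 × 2` matrices are conjugate if one invertible matrix conjugates the first
onto the second. -/
def ConjSub (V W : Submodule K (Matrix (Fin 2) (Fin 2) K)) : Prop :=
  ∃ g : GL (Fin 2) K, V.map (conjMap g).toLinearMap = W

theorem LocConjSub.symm {V W : Submodule K (Matrix (Fin 2) (Fin 2) K)} (h : LocConjSub V W) :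
    LocConjSub W V := by
  obtain ⟨f, hf⟩ := h
  exact ⟨f.symm, fun w => by simpa using (hf (f.symm w)).symm⟩

theorem LocConjSub.trans {V W X : Submodule K (Matrix (Fin 2) (Fin 2) K)} (h : LocConjSub V W)
    (h' : LocConjSub W X) : LocConjSub V X := by
  obtain ⟨f, hf⟩ := h
  obtain ⟨f', hf'⟩ := h'
  exact ⟨f.trans f', fun v => (hf v).trans (hf' (f v))⟩

theorem ConjSub.symm {V W : Submodule K (Matrix (Fin 2) (Fin 2) K)} (h : ConjSub V W) :
    ConjSub W V := by
  obtain ⟨g, rfl⟩ := h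
  refine ⟨g⁻¹, ?_⟩
  rw [← Submodule.map_comp]
  convert Submodule.map_id V
  ext1 X
  exact conjMap_inv_conjMap g X

theorem ConjSub.trans {V W X : Submodule K (Matrix (Fin 2) (Fin 2) K)} (h : ConjSub V W)
    (h' : ConjSub W X) : ConjSub V X := by
  obtain ⟨g, rfl⟩ := h
  obtain ⟨g', rfl⟩ := h'
  refine ⟨g' * g, ?_⟩
  rw [← Submodule.map_comp]
  congr 1
  ext1 X
  exact conjMap_mul g' g X

theorem ConjSub.locConjSub {V W : Submodule K (Matrix (Fin 2) (Fin 2) K)} (h : ConjSub V W) :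
    LocConjSub V W := by
  obtain ⟨g, rfl⟩ := h
  exact ⟨((conjMap g).submoduleMap V).toEquiv, fun v => ⟨g, rfl⟩⟩

theorem LocConjSub.exists_mem {V W : Submodule K (Matrix (Fin 2) (Fin 2) K)} (h : LocConjSub V W)
    {X : Matrix (Fin 2) (Fin 2) K} (hX : X ∈ V) : ∃ Y ∈ W, MatConj X Y := by
  obtain ⟨f, hf⟩ := h
  exact ⟨f ⟨X, hX⟩, (f ⟨X, hX⟩).2, hf ⟨X, hX⟩⟩

theorem LocConjSub.one_mem {V W : Submodule K (Matrix (Fin 2) (Fin 2) K)} (h : LocConjSub V W)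
    (h1 : 1 ∈ V) : 1 ∈ W := by
  obtain ⟨Y, hY, hc⟩ := h.exists_mem h1
  rwa [← hc.eq_one]

theorem LocConjSub.finrank_eq [Finite K] {V W : Submodule K (Matrix (Fin 2) (Fin 2) K)}
    (h : LocConjSub V W) : Module.finrank K V = Module.finrank K W := by
  obtain ⟨f, -⟩ := h
  have hc := Nat.card_congr f
  rw [Module.natCard_eq_pow_finrank (K := K) (V := V),
    Module.natCard_eq_pow_finrank (K := K) (V := W)] at hc
  exact Nat.pow_right_injective (Nat.succ_le_of_lt Finite.one_lt_card) hc

/-! ### The trace form and duality of local conjugacy -/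

/-- The bilinear form `(X, Y) ↦ tr (X Y)` on `2 × 2` matrices. -/
def trForm (K : Type*) [Field K] : LinearMap.BilinForm K (Matrix (Fin 2) (Fin 2) K) :=
  LinearMap.mk₂ K (fun X Y => (X * Y).trace) (by simp [add_mul]) (by simp) (by simp [mul_add])
    (by simp)

theorem trForm_apply (X Y : Matrix (Fin 2) (Fin 2) K) : trForm K X Y = (X * Y).trace := rfl

theorem trForm_isRefl : (trForm K).IsRefl := fun X Y h => by
  rw [trForm_apply] at *
  rwa [Matrix.trace_mul_comm]

theorem trForm_nondegenerate : (trForm K).Nondegenerate := by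
  refine (LinearMap.IsRefl.nondegenerate_iff_separatingLeft (B := trForm K)
    fun X Y h => trForm_isRefl X Y h).2 ?_
  intro X hX
  exact Matrix.ext_iff_trace_mul_right.2 fun Y => by simpa [trForm_apply] using hX Y

theorem mem_perp {V : Submodule K (Matrix (Fin 2) (Fin 2) K)} {Y : Matrix (Fin 2) (Fin 2) K} :
    Y ∈ (trForm K).orthogonal V ↔ ∀ X ∈ V, (X * Y).trace = 0 := Iff.rfl

theorem perp_perp (V : Submodule K (Matrix (Fin 2) (Fin 2) K)) :
    (trForm K).orthogonal ((trForm K).orthogonal V) = V :=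
  LinearMap.BilinForm.orthogonal_orthogonal trForm_nondegenerate trForm_isRefl V

theorem finrank_perp (V : Submodule K (Matrix (Fin 2) (Fin 2) K)) :
    Module.finrank K ((trForm K).orthogonal V) = 4 - Module.finrank K V := by
  rw [LinearMap.BilinForm.finrank_orthogonal trForm_nondegenerate, Module.finrank_matrix]
  simp

theorem ConjSub.perp {V W : Submodule K (Matrix (Fin 2) (Fin 2) K)} (h : ConjSub V W) :
    ConjSub ((trForm K).orthogonal V) ((trForm K).orthogonal W) := by
  obtain ⟨g, rfl⟩ := h
  refine ⟨g, ?_⟩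
  ext Y
  rw [Submodule.mem_map_equiv, mem_perp, mem_perp]
  constructor
  · rintro h _ ⟨X, hX, rfl⟩
    have := h X hX
    rw [← trace_conjMap g, conjMap_mul_mul, LinearEquiv.apply_symm_apply] at this
    exact this
  · intro h X hX
    rw [← trace_conjMap g, conjMap_mul_mul, LinearEquiv.apply_symm_apply]
    exact h _ ⟨X, hX, rfl⟩

open Classical in
/-- Orthogonality relation: the sum over a subspace `V` of an additive character composed with the
trace form detects membership in the orthogonal complement of `V`. -/
theorem sum_addChar_trace [Fintype K] {ψ : AddChar K ℂ} (hψ : ψ.IsPrimitive)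
    (V : Submodule K (Matrix (Fin 2) (Fin 2) K)) (Y : Matrix (Fin 2) (Fin 2) K) :
    ∑ X : V, ψ ((X : Matrix (Fin 2) (Fin 2) K) * Y).trace =
      if Y ∈ (trForm K).orthogonal V then (Fintype.card V : ℂ) else 0 := by
  let χ : AddChar V ℂ := ψ.compAddMonoidHom
    (((trForm K).flip Y).toAddMonoidHom.comp V.subtype.toAddMonoidHom)
  have hχ : ∀ X : V, χ X = ψ ((X : Matrix (Fin 2) (Fin 2) K) * Y).trace := fun X => rfl
  simp_rw [← hχ]
  rw [AddChar.sum_eq_ite]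
  congr 1
  rw [mem_perp, eq_iff_iff]
  constructor
  · intro h X hX
    by_contra hne
    refine hψ hne (DFunLike.ext _ _ fun c => ?_)
    have := DFunLike.congr_fun h (⟨c • X, V.smul_mem c hX⟩ : V)
    rw [hχ] at this
    simpa [AddChar.mulShift_apply, mul_comm] using this
  · intro h
    ext X
    rw [hχ, h X X.2]
    simp

open Classical in
/-- Double counting of the members of a similarity class that are orthogonal to `V`. -/
theorem card_mul_card_perp_conj [Fintype K] {ψ : AddChar K ℂ} (hψ : ψ.IsPrimitive)
    (V : Submodule K (Matrix (Fin 2) (Fin 2) K)) (Z : Matrix (Fin 2) (Fin 2) K) :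
    (Fintype.card V : ℂ) *
        Fintype.card {Y : (trForm K).orthogonal V // MatConj Z (Y : Matrix (Fin 2) (Fin 2) K)} =
      ∑ X : V, ∑ Y : {Y // MatConj Z Y},
        ψ ((X : Matrix (Fin 2) (Fin 2) K) * (Y : Matrix (Fin 2) (Fin 2) K)).trace := by
  rw [Finset.sum_comm]
  simp_rw [sum_addChar_trace hψ V]
  rw [Finset.sum_ite, Finset.sum_const_zero, add_zero, Finset.sum_const, nsmul_eq_mul, mul_comm]
  congr 2
  rw [← Fintype.card_subtype]
  exact Fintype.card_congr (Equiv.subtypeSubtypeEquivSubtypeInter _ _ |>.trans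
    ((Equiv.subtypeEquivRight fun _ => and_comm).trans
      (Equiv.subtypeSubtypeEquivSubtypeInter _ _).symm))

/-- The class function obtained by summing an additive character over a similarity class. -/
theorem sum_addChar_conj [Fintype K] [DecidableEq K] (ψ : AddChar K ℂ)
    {X X' Z : Matrix (Fin 2) (Fin 2) K} (h : MatConj X X')
    [Fintype {Y // MatConj Z Y}] :
    ∑ Y : {Y // MatConj Z Y}, ψ (X * (Y : Matrix (Fin 2) (Fin 2) K)).trace =
      ∑ Y : {Y // MatConj Z Y}, ψ (X' * (Y : Matrix (Fin 2) (Fin 2) K)).trace := by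
  obtain ⟨g, rfl⟩ := h
  let e : {Y // MatConj Z Y} ≃ {Y // MatConj Z Y} :=
    (conjMap g).toEquiv.subtypeEquiv fun Y =>
      ⟨fun h => h.trans ⟨g, rfl⟩, fun h => h.trans (MatConj.symm ⟨g, rfl⟩)⟩
  refine Fintype.sum_equiv e _ _ fun Y => ?_
  have : ((e Y : {Y // MatConj Z Y}) : Matrix (Fin 2) (Fin 2) K) = conjMap g Y := rfl
  rw [this, ← conjMap_mul_mul, trace_conjMap]

/-- Local conjugacy passes to orthogonal complements for the trace form: the Fourier transform of
the indicator function of `V` is a multiple of that of its complement, and the Fourier transform of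
a class function is a class function. -/
theorem LocConjSub.perp [Finite K] {V W : Submodule K (Matrix (Fin 2) (Fin 2) K)}
    (h : LocConjSub V W) :
    LocConjSub ((trForm K).orthogonal V) ((trForm K).orthogonal W) := by
  classical
  have := Fintype.ofFinite K
  obtain ⟨ψ, hψ⟩ : ∃ ψ : AddChar K ℂ, ψ.IsPrimitive := by
    exact ⟨_, AddChar.FiniteField.primitiveChar_to_Complex_isPrimitive K⟩
  obtain ⟨f, hf⟩ := h
  have key : ∀ Z, Fintype.card {Y : (trForm K).orthogonal V // MatConj Z Y.1} =
      Fintype.card {Y : (trForm K).orthogonal W // MatConj Z Y.1} := by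
    intro Z
    have h1 := card_mul_card_perp_conj hψ V Z
    have h2 := card_mul_card_perp_conj hψ W Z
    rw [Fintype.sum_equiv f _ (fun X : W => ∑ Y : {Y // MatConj Z Y}, ψ (X.1 * Y.1).trace)
      fun X => sum_addChar_conj ψ (hf X), ← h2, Fintype.card_congr f] at h1
    have h0 : (Fintype.card W : ℂ) ≠ 0 := by
      exact_mod_cast Fintype.card_ne_zero
    exact_mod_cast mul_left_cancel₀ h0 h1
  let q := fun (V : Submodule K (Matrix (Fin 2) (Fin 2) K)) (Y : V) =>
    Quotient.mk (matConjSetoid K) (Y : Matrix (Fin 2) (Fin 2) K)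
  have e : ∀ c, Nonempty ({Y // q ((trForm K).orthogonal V) Y = c} ≃
      {Y // q ((trForm K).orthogonal W) Y = c}) := by
    intro c
    induction c using Quotient.inductionOn with
    | h Z =>
      have hq : ∀ (V : Submodule K (Matrix (Fin 2) (Fin 2) K)) (Y : V),
          q V Y = Quotient.mk (matConjSetoid K) Z ↔ MatConj Z Y := fun V Y =>
        ⟨fun h => (Quotient.exact h : MatConj _ _).symm, fun h => Quotient.sound h.symm⟩
      simp_rw [hq]
      exact ⟨Fintype.equivOfCardEq (key Z)⟩
  refine ⟨Equiv.ofFiberEquiv fun c => (e c).some, fun v => ?_⟩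
  exact (Quotient.exact (Equiv.ofFiberEquiv_map (fun c => (e c).some) v) : MatConj _ _).symm

end LinearAlgebra

/-! ### Classification of locally conjugate subspaces of `2 × 2` matrices -/

section Classification

variable {K : Type*} [Field K]

theorem det_add_smul_of_trace_eq_zero {A B : Matrix (Fin 2) (Fin 2) K} (hA : A.trace = 0) (x : K) :
    (B + x • A).det = B.det - x * (A * B).trace + x ^ 2 * A.det := by
  rw [Matrix.trace_fin_two] at hA
  simp only [Matrix.det_fin_two, Matrix.trace_fin_two, Matrix.add_apply, Matrix.smul_apply,
    smul_eq_mul, Matrix.mul_apply, Fin.sum_univ_two]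
  linear_combination (x * (B 0 0 + B 1 1)) * hA

theorem single_ne_zero : (!![0, 1; 0, 0] : Matrix (Fin 2) (Fin 2) K) ≠ 0 := fun h => by
  have := congrFun (congrFun h 0) 1
  simp at this

theorem trace_single : (!![0, 1; 0, 0] : Matrix (Fin 2) (Fin 2) K).trace = 0 := by
  simp [Matrix.trace_fin_two]

theorem det_add_smul_single (B : Matrix (Fin 2) (Fin 2) K) (x : K) :
    (B + x • !![0, 1; 0, 0]).det = B.det - x * B 1 0 := by
  simp [Matrix.det_fin_two]
  ring

theorem ConjSub.refl (V : Submodule K (Matrix (Fin 2) (Fin 2) K)) : ConjSub V V :=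
  ⟨1, by
    convert Submodule.map_id V
    ext1 X
    simp [conjMap_apply]⟩

theorem finrank_map_conjMap (g : GL (Fin 2) K) (V : Submodule K (Matrix (Fin 2) (Fin 2) K)) :
    Module.finrank K (V.map (conjMap g).toLinearMap) = Module.finrank K V :=
  ((conjMap g).submoduleMap V).finrank_eq.symm

/-- Polarized Cayley–Hamilton identity for traceless matrices. -/
theorem mul_add_mul_of_trace_eq_zero {X Y : Matrix (Fin 2) (Fin 2) K} (hX : X.trace = 0)
    (hY : Y.trace = 0) : X * Y + Y * X = (X * Y).trace • (1 : Matrix (Fin 2) (Fin 2) K) := by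
  rw [Matrix.trace_fin_two] at hX hY
  have hX' : X 1 1 = -X 0 0 := by linear_combination hX
  have hY' : Y 1 1 = -Y 0 0 := by linear_combination hY
  ext i j
  fin_cases i <;> fin_cases j <;>
    simp [Matrix.mul_apply, Fin.sum_univ_two, Matrix.trace_fin_two, hX', hY'] <;> ring

theorem mul_self_of_trace_eq_zero {X : Matrix (Fin 2) (Fin 2) K} (hX : X.trace = 0) :
    X * X = (-X.det) • (1 : Matrix (Fin 2) (Fin 2) K) := by
  rw [Matrix.trace_fin_two] at hX
  have hX' : X 1 1 = -X 0 0 := by linear_combination hX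
  ext i j
  fin_cases i <;> fin_cases j <;>
    simp [Matrix.mul_apply, Fin.sum_univ_two, Matrix.det_fin_two, hX'] <;> ring

theorem trace_mul_self_of_trace_eq_zero {X : Matrix (Fin 2) (Fin 2) K} (hX : X.trace = 0) :
    (X * X).trace = -2 * X.det := by
  rw [mul_self_of_trace_eq_zero hX]
  simp
  ring

theorem isUnit_of_det_ne_zero {X : Matrix (Fin 2) (Fin 2) K} (h : X.det ≠ 0) : IsUnit X :=
  (Matrix.isUnit_iff_isUnit_det X).2 (isUnit_iff_ne_zero.2 h)

/-- A singular traceless matrix commuting with an invertible traceless matrix is zero. -/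
theorem eq_zero_of_commute_of_trace_eq_zero (h2 : (2 : K) ≠ 0) {N J : Matrix (Fin 2) (Fin 2) K}
    (hN : N.trace = 0) (hJ : J.trace = 0) (hNd : N.det = 0) (hJd : J.det ≠ 0)
    (hc : N * J = J * N) : N = 0 := by
  have h1 := mul_add_mul_of_trace_eq_zero hN hJ
  rw [← hc] at h1
  have hNN := mul_self_of_trace_eq_zero hN
  rw [hNd, neg_zero, zero_smul] at hNN
  have h3 : (N * J + N * J) * (N * J + N * J) = 0 := by
    have : N * J * (N * J) = 0 := by
      rw [mul_assoc, ← mul_assoc J, ← hc, ← mul_assoc, ← mul_assoc, hNN, zero_mul, zero_mul]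
    simp [mul_add, add_mul, this]
  rw [h1] at h3
  have ht : (N * J).trace = 0 := by
    have := congrFun (congrFun h3 0) 0
    simpa using this
  rw [ht, zero_smul, ← two_smul K, smul_eq_zero] at h1
  have h4 := h1.resolve_left h2
  exact (isUnit_of_det_ne_zero hJd).mul_left_eq_zero.1 h4

/-- Two matrices, one traceless and nonzero, the other of nonzero trace, span any plane
containing them. -/
theorem eq_span_pair {V : Submodule K (Matrix (Fin 2) (Fin 2) K)} (hV : Module.finrank K V = 2)
    {X Y : Matrix (Fin 2) (Fin 2) K} (hX0 : X ≠ 0) (hX : X.trace = 0) (hY : Y.trace ≠ 0)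
    (hXV : X ∈ V) (hYV : Y ∈ V) : Submodule.span K {X, Y} = V := by
  refine Submodule.eq_of_le_of_finrank_eq ?_ ?_
  · rw [Submodule.span_le]
    rintro _ (rfl | rfl) <;> assumption
  · rw [hV]
    have hli : LinearIndependent K ![X, Y] := by
      rw [LinearIndependent.pair_iff]
      intro s t h
      have ht : t = 0 := by
        have := congrArg Matrix.trace h
        simpa [hX, hY] using this
      subst ht
      simpa [hX0] using h
    have := finrank_span_eq_card hli
    rwa [Matrix.range_cons_cons_empty, Fintype.card_fin] at this

theorem conjSub_of_pair {V W : Submodule K (Matrix (Fin 2) (Fin 2) K)}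
    (hV : Module.finrank K V = 2) (hW : Module.finrank K W = 2)
    {X Y : Matrix (Fin 2) (Fin 2) K} (hX0 : X ≠ 0) (hX : X.trace = 0) (hY : Y.trace ≠ 0)
    (hXV : X ∈ V) (hYV : Y ∈ V) (g : GL (Fin 2) K) (hXW : conjMap g X ∈ W)
    (hYW : conjMap g Y ∈ W) : ConjSub V W := by
  refine ⟨g, ?_⟩
  rw [← eq_span_pair hV hX0 hX hY hXV hYV, Submodule.map_span, Set.image_pair]
  exact eq_span_pair hW (by simpa using hX0) (by simpa [trace_conjMap] using hX)
    (by simpa [trace_conjMap] using hY) hXW hYW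

theorem exists_trace_eq_zero {V : Submodule K (Matrix (Fin 2) (Fin 2) K)}
    (hV : 2 ≤ Module.finrank K V) : ∃ A ∈ V, A ≠ 0 ∧ A.trace = 0 := by
  by_contra! h
  have hinj : Function.Injective ((Matrix.traceLinearMap (Fin 2) K K).domRestrict V) := by
    rw [← LinearMap.ker_eq_bot, LinearMap.ker_eq_bot']
    intro X hX
    by_contra hne
    exact h X X.2 (by simpa using hne) hX
  have := LinearMap.finrank_le_finrank_of_injective hinj
  rw [Module.finrank_self] at this
  omega

theorem exists_trace_eq_one {V : Submodule K (Matrix (Fin 2) (Fin 2) K)}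
    (hV : ¬ ∀ X ∈ V, X.trace = 0) : ∃ B ∈ V, B.trace = 1 := by
  push Not at hV
  obtain ⟨X, hX, hX0⟩ := hV
  exact ⟨X.trace⁻¹ • X, V.smul_mem _ hX, by simp [hX0]⟩

/-- In a plane spanned by a traceless matrix `A` and a matrix `B` of trace `1`, the matrices of
trace `1` are the `B + x • A`. -/
theorem exists_eq_add_smul {V : Submodule K (Matrix (Fin 2) (Fin 2) K)}
    (hV : Module.finrank K V = 2) {A B : Matrix (Fin 2) (Fin 2) K} (hA0 : A ≠ 0)
    (hA : A.trace = 0) (hB : B.trace = 1) (hAV : A ∈ V) (hBV : B ∈ V)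
    {X : Matrix (Fin 2) (Fin 2) K} (hX : X ∈ V) (hX1 : X.trace = 1) : ∃ x : K, X = B + x • A := by
  rw [← eq_span_pair hV hA0 hA (by simp [hB]) hAV hBV, Submodule.mem_span_pair] at hX
  obtain ⟨s, t, rfl⟩ := hX
  have ht : t = 1 := by simpa [hA, hB] using hX1
  exact ⟨s, by rw [ht, one_smul, add_comm]⟩

theorem conjSub_of_finrank_one [Finite K] {V W : Submodule K (Matrix (Fin 2) (Fin 2) K)}
    (h : LocConjSub V W) (hV : Module.finrank K V = 1) : ConjSub V W := by
  have hW := h.finrank_eq.symm.trans hV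
  obtain ⟨⟨v, hvV⟩, hv0, -⟩ := finrank_eq_one_iff'.1 hV
  have hv0' : v ≠ 0 := by simpa using hv0
  obtain ⟨w, hw, g, rfl⟩ := h.exists_mem hvV
  refine ⟨g, Submodule.eq_of_le_of_finrank_eq ?_ ?_⟩
  · rintro _ ⟨X, hX, rfl⟩
    obtain ⟨c, hc⟩ := exists_smul_eq_of_finrank_eq_one hV hv0 ⟨X, hX⟩
    have : c • v = X := congrArg Subtype.val hc
    rw [← this, map_smul]
    exact W.smul_mem c hw
  · rw [finrank_map_conjMap, hV, hW]

/-- A nonzero nilpotent matrix is similar to the elementary matrix. -/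
theorem exists_conjMap_eq_single {C : Matrix (Fin 2) (Fin 2) K} (h0 : C ≠ 0) (ht : C.trace = 0)
    (hd : C.det = 0) : ∃ g : GL (Fin 2) K, conjMap g C = !![0, 1; 0, 0] := by
  have hCC : C * C = 0 := by rw [mul_self_of_trace_eq_zero ht, hd]; simp
  obtain ⟨v, hv⟩ : ∃ v : Fin 2 → K, C.mulVec v ≠ 0 := by
    by_contra! h
    exact h0 (Matrix.mulVec_injective (funext fun v => by simp [h v]))
  have hCv : C.mulVec (C.mulVec v) = 0 := by rw [Matrix.mulVec_mulVec, hCC, Matrix.zero_mulVec]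
  set u := C.mulVec v with hu
  let P : Matrix (Fin 2) (Fin 2) K := !![u 0, v 0; u 1, v 1]
  have hP : P.det ≠ 0 := by
    intro hP
    -- A vanishing determinant makes `v` a multiple of `u`, which `C` kills.
    have hd' : u 0 * v 1 - v 0 * u 1 = 0 := by simpa [P, Matrix.det_fin_two] using hP
    have e1 : u 0 • v = v 0 • u := by
      ext i; fin_cases i
      · exact mul_comm _ _
      · simp; linear_combination hd'
    have e2 : u 1 • v = v 1 • u := by
      ext i; fin_cases i
      · simp; linear_combination -hd'
      · exact mul_comm _ _
    have f1 := congrArg C.mulVec e1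
    have f2 := congrArg C.mulVec e2
    rw [Matrix.mulVec_smul, Matrix.mulVec_smul, hCv, smul_zero, ← hu, smul_eq_zero] at f1 f2
    have g1 := f1.resolve_right hv
    have g2 := f2.resolve_right hv
    exact hv (funext fun i => by fin_cases i <;> simp [g1, g2])
  refine ⟨(Matrix.GeneralLinearGroup.mkOfDetNeZero P hP)⁻¹, ?_⟩
  have : conjMap (Matrix.GeneralLinearGroup.mkOfDetNeZero P hP) !![0, 1; 0, 0] = C := by
    rw [conjMap_eq_iff]
    change P * _ = C * P
    have h00 := congrFun hCv 0
    have h01 := congrFun hCv 1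
    have h10 := congrFun hu 0
    have h11 := congrFun hu 1
    simp only [Matrix.mulVec, dotProduct, Fin.sum_univ_two, Pi.zero_apply] at h00 h01 h10 h11
    ext i j
    fin_cases i <;> fin_cases j <;>
      simp [P, Matrix.mul_apply, Fin.sum_univ_two, h00, h01] <;> assumption
  rw [← this, conjMap_inv_conjMap]

/-- A plane spanned by an invertible traceless `A` and by `1/2 + C`, with `C` nonzero nilpotent and
anticommuting with `A`, has a normal form. -/
theorem conjSub_normalForm_of_nilpotent (h2 : (2 : K) ≠ 0)
    {V : Submodule K (Matrix (Fin 2) (Fin 2) K)} (hV : Module.finrank K V = 2)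
    {A C : Matrix (Fin 2) (Fin 2) K} (hA : A.trace = 0) (hAd : A.det ≠ 0) (hAV : A ∈ V)
    (hC0 : C ≠ 0) (hC : C.trace = 0) (hCd : C.det = 0) (hAC : (A * C).trace = 0)
    (hCV : (2⁻¹ : K) • 1 + C ∈ V) :
    ConjSub V (Submodule.span K {!![1, 0; 0, -1], !![2⁻¹, 1; 0, 2⁻¹]}) := by
  obtain ⟨g, hg⟩ := exists_conjMap_eq_single hC0 hC hCd
  set A' := conjMap g A with hA'
  have hA't : A'.trace = 0 := by rw [hA', trace_conjMap, hA]
  have hA'd : A'.det ≠ 0 := by rwa [hA', det_conjMap]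
  have h10 : A' 1 0 = 0 := by
    rw [← trace_conjMap g, conjMap_mul_mul, hg, ← hA'] at hAC
    simpa [Matrix.trace_fin_two, Matrix.mul_apply, Fin.sum_univ_two] using hAC
  have h11 : A' 1 1 = -A' 0 0 := by
    rw [Matrix.trace_fin_two] at hA't
    linear_combination hA't
  have h00 : A' 0 0 ≠ 0 := by
    intro h
    rw [Matrix.det_fin_two, h10, h] at hA'd
    simp at hA'd
  -- The unipotent matrix fixing the elementary matrix and diagonalizing `A'`.
  let u : GL (Fin 2) K := Matrix.GeneralLinearGroup.mkOfDetNeZero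
    !![1, A' 0 1 / (2 * A' 0 0); 0, 1] (by simp)
  have huA : conjMap (u * g) A = A' 0 0 • !![1, 0; 0, -1] := by
    rw [conjMap_mul, ← hA', conjMap_eq_iff]
    change !![1, A' 0 1 / (2 * A' 0 0); 0, 1] * _ = _ * !![1, A' 0 1 / (2 * A' 0 0); 0, 1]
    ext i j
    fin_cases i <;> fin_cases j <;> simp [Matrix.mul_apply, Fin.sum_univ_two, h10, h11]
    field_simp
    ring
  have huC : conjMap (u * g) ((2⁻¹ : K) • 1 + C) = !![2⁻¹, 1; 0, 2⁻¹] := by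
    rw [conjMap_mul, map_add, map_smul, conjMap_one, hg, conjMap_eq_iff]
    change !![1, A' 0 1 / (2 * A' 0 0); 0, 1] * _ = _ * !![1, A' 0 1 / (2 * A' 0 0); 0, 1]
    ext i j
    fin_cases i <;> fin_cases j <;> simp [Matrix.mul_apply, Fin.sum_univ_two]
    ring
  have hA0 : A ≠ 0 := by rintro rfl; simp at hAd
  have htr : ((2⁻¹ : K) • 1 + C).trace ≠ 0 := by
    rw [Matrix.trace_add, Matrix.trace_smul, hC]
    simp [h2]
  refine ⟨u * g, ?_⟩
  rw [← eq_span_pair hV hA0 hA htr hAV hCV, Submodule.map_span, Set.image_pair]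
  change Submodule.span K {conjMap (u * g) A, conjMap (u * g) ((2⁻¹ : K) • 1 + C)} = _
  rw [huA, huC, Submodule.span_insert, Submodule.span_insert,
    Submodule.span_singleton_smul_eq (isUnit_iff_ne_zero.2 h00)]

/-- A plane containing the elementary matrix `E₁₂` and a matrix of trace `1` that is not upper
triangular has a normal form. -/
theorem conjSub_normalForm_of_single_mem {V : Submodule K (Matrix (Fin 2) (Fin 2) K)}
    (hV : Module.finrank K V = 2) (hE : !![0, 1; 0, 0] ∈ V) {B : Matrix (Fin 2) (Fin 2) K}
    (hB : B.trace = 1) (hBV : B ∈ V) (h10 : B 1 0 ≠ 0) :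
    ConjSub V (Submodule.span K {!![0, 1; 0, 0], !![0, 0; 1, 1]}) := by
  have h11 : B 1 1 = 1 - B 0 0 := by
    rw [Matrix.trace_fin_two] at hB
    linear_combination hB
  -- An upper triangular matrix clearing the upper left entry of `B` and scaling `B 1 0` to `1`.
  let P : Matrix (Fin 2) (Fin 2) K := !![B 1 0, -B 0 0; 0, 1]
  let g : GL (Fin 2) K := Matrix.GeneralLinearGroup.mkOfDetNeZero P (by simpa [P] using h10)
  have hgE : conjMap g !![0, 1; 0, 0] = B 1 0 • !![0, 1; 0, 0] := by
    rw [conjMap_eq_iff]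
    change P * _ = _ * P
    ext i j
    fin_cases i <;> fin_cases j <;> simp [P, Matrix.mul_apply, Fin.sum_univ_two]
  have hgB : conjMap g B = (B 1 0 * B 0 1 - B 0 0 * B 1 1) • !![0, 1; 0, 0] + !![0, 0; 1, 1] := by
    rw [conjMap_eq_iff]
    change P * _ = _ * P
    ext i j
    fin_cases i <;> fin_cases j <;> simp [P, Matrix.mul_apply, Fin.sum_univ_two, h11] <;> ring
  refine ⟨g, ?_⟩
  rw [← eq_span_pair hV single_ne_zero (by simp [Matrix.trace_fin_two]) (by simp [hB]) hE hBV,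
    Submodule.map_span, Set.image_pair]
  change Submodule.span K {conjMap g _, conjMap g B} = _
  rw [hgE, hgB]
  refine le_antisymm (Submodule.span_le.2 ?_) (Submodule.span_le.2 ?_)
  · rintro _ (rfl | rfl)
    · exact Submodule.mem_span_pair.2 ⟨B 1 0, 0, by simp⟩
    · exact Submodule.mem_span_pair.2
        ⟨B 1 0 * B 0 1 - B 0 0 * B 1 1, 1, by rw [one_smul]⟩
  · rintro _ (rfl | rfl)
    · exact Submodule.mem_span_pair.2 ⟨(B 1 0)⁻¹, 0, by simp [h10]⟩
    · exact Submodule.mem_span_pair.2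
        ⟨-(B 1 0 * B 0 1 - B 0 0 * B 1 1) * (B 1 0)⁻¹, 1, by
          rw [smul_smul, inv_mul_cancel_right₀ h10, neg_smul, one_smul, neg_add_cancel_left]⟩

/-- The exceptional pairs of planes: up to conjugacy, both are spanned by `E₁₂` and a diagonal
matrix, and the two diagonal matrices differ by exchanging their entries. -/
def ExceptionalSub (V W : Submodule K (Matrix (Fin 2) (Fin 2) K)) : Prop :=
  ∃ a b : K, ConjSub V (Submodule.span K {!![0, 1; 0, 0], !![a, 0; 0, b]}) ∧
    ConjSub W (Submodule.span K {!![0, 1; 0, 0], !![b, 0; 0, a]})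

/-- If the planes contain `E₁₂` and matrices of trace `1`, then the determinants of the latter
decide whether the planes are upper triangular. -/
theorem LocConjSub.apply_one_zero_eq_zero {V W : Submodule K (Matrix (Fin 2) (Fin 2) K)}
    (h : LocConjSub V W) (hV : Module.finrank K V = 2)
    (hEV : !![0, 1; 0, 0] ∈ V) (hEW : !![0, 1; 0, 0] ∈ W) {B B' : Matrix (Fin 2) (Fin 2) K}
    (hB : B.trace = 1) (hB' : B'.trace = 1) (hBV : B ∈ V) (hBW : B' ∈ W) (h10 : B 1 0 = 0) :
    B' 1 0 = 0 := by
  by_contra hne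
  -- In `W` the trace `1` matrices take every determinant, in `V` only the determinant of `B`.
  let Y := B' + ((B'.det - B.det - 1) * (B' 1 0)⁻¹) • !![0, 1; 0, 0]
  have hY : Y ∈ W := W.add_mem hBW (W.smul_mem _ hEW)
  have hYt : Y.trace = 1 := by simp [Y, hB']
  have hYd : Y.det = B.det + 1 := by
    rw [det_add_smul_single, inv_mul_cancel_right₀ hne]
    ring
  obtain ⟨X, hX, hc⟩ := h.symm.exists_mem hY
  obtain ⟨x, rfl⟩ := exists_eq_add_smul hV single_ne_zero trace_single hB hEV hBV hX
    (hc.trace_eq.trans hYt)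
  have hd := hc.det_eq
  rw [det_add_smul_single, hYd, h10] at hd
  simp at hd

/-- Planes containing `E₁₂` and matrices of trace `1`. -/
theorem LocConjSub.conjSub_or_of_single_mem {V W : Submodule K (Matrix (Fin 2) (Fin 2) K)}
    (h : LocConjSub V W) (hV : Module.finrank K V = 2) (hW : Module.finrank K W = 2)
    (hEV : !![0, 1; 0, 0] ∈ V) (hEW : !![0, 1; 0, 0] ∈ W) {B B' : Matrix (Fin 2) (Fin 2) K}
    (hB : B.trace = 1) (hB' : B'.trace = 1) (hBV : B ∈ V) (hBW : B' ∈ W) :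
    ConjSub V W ∨ ExceptionalSub V W := by
  by_cases h10 : B 1 0 = 0
  · have h10' := h.apply_one_zero_eq_zero hV hEV hEW hB hB' hBV hBW h10
    -- Both planes are spanned by `E₁₂` and a diagonal matrix of trace `1`.
    have diag : ∀ {V : Submodule K (Matrix (Fin 2) (Fin 2) K)}, Module.finrank K V = 2 →
        !![0, 1; 0, 0] ∈ V → ∀ {B : Matrix (Fin 2) (Fin 2) K}, B.trace = 1 → B ∈ V → B 1 0 = 0 →
        V = Submodule.span K {!![0, 1; 0, 0], !![B 0 0, 0; 0, 1 - B 0 0]} := by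
      intro V hV hE B hB hBV h10
      refine (eq_span_pair hV single_ne_zero trace_single
        (by simp [Matrix.trace_fin_two]) hE ?_).symm
      convert V.sub_mem hBV (V.smul_mem (B 0 1) hE) using 1
      rw [Matrix.trace_fin_two] at hB
      ext i j
      fin_cases i <;> fin_cases j <;> simp [h10]
      linear_combination -hB
    have hV' := diag hV hEV hB hBV h10
    have hW' := diag hW hEW hB' hBW h10'
    obtain ⟨Y, hY, hc⟩ := h.exists_mem hBV
    obtain ⟨x, rfl⟩ := exists_eq_add_smul hW single_ne_zero trace_single hB' hEW hBW hY
      (hc.trace_eq.trans hB)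
    have hd := hc.det_eq
    rw [det_add_smul_single, Matrix.det_fin_two, Matrix.det_fin_two, h10, h10'] at hd
    rw [Matrix.trace_fin_two] at hB hB'
    have hroot : (B' 0 0 - B 0 0) * (B' 0 0 - (1 - B 0 0)) = 0 := by
      linear_combination -hd + B' 0 0 * hB' - B 0 0 * hB
    rcases mul_eq_zero.1 hroot with h0 | h0
    · left
      rw [hV', hW', sub_eq_zero.1 h0]
      exact ConjSub.refl _
    · right
      refine ⟨B 0 0, 1 - B 0 0, ?_, ?_⟩
      · rw [← hV']
        exact ConjSub.refl V
      · have : B 0 0 = 1 - B' 0 0 := by linear_combination h0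
        rw [this, sub_sub_cancel, ← hW']
        exact ConjSub.refl W
  · have h10' : B' 1 0 ≠ 0 := fun h0 =>
      h10 (h.symm.apply_one_zero_eq_zero hW hEW hEV hB' hB hBW hBV h0)
    exact Or.inl ((conjSub_normalForm_of_single_mem hV hEV hB hBV h10).trans
      (conjSub_normalForm_of_single_mem hW hEW hB' hBW h10').symm)

/-- Planes sharing a traceless invertible matrix and containing matrices of trace `1`, but not the
identity. -/
theorem LocConjSub.conjSub_of_det_ne_zero (h2 : (2 : K) ≠ 0)
    {V W : Submodule K (Matrix (Fin 2) (Fin 2) K)} (h : LocConjSub V W)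
    (hV : Module.finrank K V = 2) (hW : Module.finrank K W = 2) (h1 : 1 ∉ V)
    {A B B' : Matrix (Fin 2) (Fin 2) K} (hA : A.trace = 0) (hAd : A.det ≠ 0)
    (hAV : A ∈ V) (hAW : A ∈ W) (hB : B.trace = 1) (hB' : B'.trace = 1) (hBV : B ∈ V)
    (hBW : B' ∈ W) : ConjSub V W := by
  have hA0 : A ≠ 0 := by rintro rfl; simp at hAd
  -- The matrices of trace `1` may be chosen orthogonal to `A`.
  wlog hAB : (A * B).trace = 0 generalizing B
  · refine this (B := B + ((A * B).trace / (2 * A.det)) • A) (by simp [hA, hB])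
      (V.add_mem hBV (V.smul_mem _ hAV)) ?_
    rw [mul_add, Matrix.trace_add, mul_smul_comm, Matrix.trace_smul,
      trace_mul_self_of_trace_eq_zero hA, smul_eq_mul]
    field_simp
    ring
  wlog hAB' : (A * B').trace = 0 generalizing B'
  · refine this (B' := B' + ((A * B').trace / (2 * A.det)) • A) (by simp [hA, hB'])
      (W.add_mem hBW (W.smul_mem _ hAW)) ?_
    rw [mul_add, Matrix.trace_add, mul_smul_comm, Matrix.trace_smul,
      trace_mul_self_of_trace_eq_zero hA, smul_eq_mul]
    field_simp
    ring
  -- Among the matrices of trace `1`, only `B` (in `V`) and `B'` (in `W`) have a determinant that is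
  -- not shared with another one, so they correspond to each other.
  have hconj : MatConj B B' := by
    obtain ⟨f, hf⟩ := h
    have hc := hf ⟨B, hBV⟩
    obtain ⟨x, hx⟩ := exists_eq_add_smul hW hA0 hA hB' hAW hBW (f ⟨B, hBV⟩).2
      (hc.trace_eq.trans hB)
    have hY : B' + (-x) • A ∈ W := W.add_mem hBW (W.smul_mem _ hAW)
    have hc' := hf (f.symm ⟨_, hY⟩)
    rw [Equiv.apply_symm_apply] at hc'
    obtain ⟨y, hy⟩ := exists_eq_add_smul hV hA0 hA hB hAV hBV (f.symm ⟨_, hY⟩).2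
      (by rw [← hc'.trace_eq]; simp [hA, hB'])
    have hd := hc.det_eq
    have hd' := hc'.det_eq
    rw [hx, det_add_smul_of_trace_eq_zero hA, hAB'] at hd
    rw [hy, det_add_smul_of_trace_eq_zero hA, det_add_smul_of_trace_eq_zero hA, hAB', hAB] at hd'
    have hy2 : y ^ 2 * A.det = 0 := by linear_combination hd - hd'
    have hy0 : y = 0 := by simpa [hAd] using hy2
    rw [hy0, zero_smul, add_zero] at hy
    have hfe : f ⟨B, hBV⟩ = ⟨_, hY⟩ := by
      rw [← Equiv.eq_symm_apply]
      exact Subtype.ext hy.symm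
    have hx' : B' + x • A = B' + (-x) • A := by rw [← hx, hfe]
    rw [add_right_inj, neg_smul, ← sub_eq_zero, sub_neg_eq_add, ← two_smul K, smul_eq_zero,
      smul_eq_zero] at hx'
    have hx0 : x = 0 := (hx'.resolve_left h2).resolve_right hA0
    rw [hx0, zero_smul, add_zero] at hx
    rwa [← hx]
  set C := B - (2⁻¹ : K) • 1 with hCdef
  set C' := B' - (2⁻¹ : K) • 1 with hCdef'
  have hCC' : MatConj C C' := by
    obtain ⟨g, rfl⟩ := hconj
    exact ⟨g, by simp [hCdef, hCdef']⟩
  have hBC : (2⁻¹ : K) • 1 + C = B := by simp [hCdef]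
  have hBC' : (2⁻¹ : K) • 1 + C' = B' := by simp [hCdef']
  have hC : C.trace = 0 := by simp [hCdef, hB, h2]
  have hC' : C'.trace = 0 := by rw [hCC'.trace_eq, hC]
  have hAC : (A * C).trace = 0 := by simp [hCdef, mul_sub, hAB, hA]
  have hAC' : (A * C').trace = 0 := by simp [hCdef', mul_sub, hAB', hA]
  have hC0 : C ≠ 0 := by
    intro h0
    apply h1
    rw [h0, add_zero] at hBC
    have := V.smul_mem 2 hBV
    rwa [← hBC, smul_smul, mul_inv_cancel₀ h2, one_smul] at this
  by_cases hCd : C.det = 0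
  · exact (conjSub_normalForm_of_nilpotent h2 hV hA hAd hAV hC0 hC hCd hAC (hBC ▸ hBV)).trans
      (conjSub_normalForm_of_nilpotent h2 hW hA hAd hAW (mt hCC'.eq_zero_iff.1 hC0) hC'
        (hCC'.det_eq.trans hCd) hAC' (hBC' ▸ hBW)).symm
  -- It suffices to find an invertible matrix that commutes with `A` and takes `C` to `C'`. As in the
  -- proof of the Skolem–Noether theorem, `C * C + C' * C` is one if it is invertible; otherwise
  -- `C' = -C`, and `A` itself is one.
  have finish : ∀ P : Matrix (Fin 2) (Fin 2) K, P.det ≠ 0 → P * A = A * P → P * C = C' * P →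
      ConjSub V W := by
    intro P hP hPA hPC
    let g := Matrix.GeneralLinearGroup.mkOfDetNeZero P hP
    have hgA : conjMap g A = A := conjMap_eq_iff.2 hPA
    have hgC : conjMap g C = C' := conjMap_eq_iff.2 hPC
    refine conjSub_of_pair hV hW hA0 hA (by simp [hB]) hAV hBV g (by rwa [hgA]) ?_
    rwa [← hBC, map_add, map_smul, conjMap_one, hgC, hBC']
  have aAC := mul_add_mul_of_trace_eq_zero hA hC
  have aAC' := mul_add_mul_of_trace_eq_zero hA hC'
  rw [hAC, zero_smul] at aAC
  rw [hAC', zero_smul] at aAC'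
  have eAC : C * A = -(A * C) := by rw [← add_eq_zero_iff_eq_neg, add_comm]; exact aAC
  have eAC' : C' * A = -(A * C') := by rw [← add_eq_zero_iff_eq_neg, add_comm]; exact aAC'
  have sC := mul_self_of_trace_eq_zero hC
  have sC' := mul_self_of_trace_eq_zero hC'
  rw [hCC'.det_eq] at sC'
  by_cases hP : ((-C.det) • (1 : Matrix (Fin 2) (Fin 2) K) + C' * C).det = 0
  · -- Then `C + C'` is nilpotent and commutes with the invertible matrix `A * C`.
    have hN : (C + C').trace = 0 := by simp [hC, hC']
    have hNd' : (-C.det) • (1 : Matrix (Fin 2) (Fin 2) K) + C' * C = (C + C') * C := by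
      rw [add_mul, sC]
    have hNd : (C + C').det = 0 := by
      rw [hNd', Matrix.det_mul] at hP
      exact (mul_eq_zero.1 hP).resolve_right hCd
    have hNC : ((C + C') * C).trace = 0 := by
      have e := det_add_smul_of_trace_eq_zero (B := C) hC' 1
      rw [one_smul, hNd, hCC'.det_eq] at e
      rw [add_mul, Matrix.trace_add, trace_mul_self_of_trace_eq_zero hC]
      linear_combination e
    have aNC := mul_add_mul_of_trace_eq_zero hN hC
    rw [hNC, zero_smul] at aNC
    have eNC : C * (C + C') = -((C + C') * C) := by
      rw [← add_eq_zero_iff_eq_neg, add_comm]; exact aNC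
    have eNA : (C + C') * A = -(A * (C + C')) := by
      rw [add_mul, eAC, eAC', mul_add, neg_add]
    have hN0 : C + C' = 0 := by
      refine eq_zero_of_commute_of_trace_eq_zero h2 hN hAC hNd
        (by rw [Matrix.det_mul]; exact mul_ne_zero hAd hCd) ?_
      rw [← mul_assoc, eNA, neg_mul, mul_assoc, mul_assoc, eNC, mul_neg]
    refine finish A hAd rfl ?_
    rw [eq_neg_of_add_eq_zero_right hN0, neg_mul, eAC, neg_neg]
  · refine finish _ hP ?_ ?_
    · rw [add_mul, mul_add, mul_assoc, eAC, mul_neg, ← mul_assoc, eAC', neg_mul, neg_neg, mul_assoc]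
      simp
    · rw [add_mul, mul_add, mul_assoc C' C C, sC, ← mul_assoc C' C' C, sC']
      simp [add_comm]

/-- Locally conjugate planes containing the identity are conjugate. -/
theorem LocConjSub.conjSub_of_one_mem (h2 : (2 : K) ≠ 0)
    {V W : Submodule K (Matrix (Fin 2) (Fin 2) K)} (h : LocConjSub V W)
    (hV : Module.finrank K V = 2) (hW : Module.finrank K W = 2) (h1 : 1 ∈ V) : ConjSub V W := by
  obtain ⟨A, hAV, hA0, hA⟩ := exists_trace_eq_zero hV.ge
  obtain ⟨A', hAW, g, rfl⟩ := h.exists_mem hAV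
  exact conjSub_of_pair hV hW hA0 hA (by simpa using h2) hAV h1 g hAW
    (by simpa using h.one_mem h1)

theorem LocConjSub.conjSub_or_of_finrank_two [Finite K] (h2 : (2 : K) ≠ 0)
    {V W : Submodule K (Matrix (Fin 2) (Fin 2) K)} (h : LocConjSub V W)
    (hV : Module.finrank K V = 2) : ConjSub V W ∨ ExceptionalSub V W := by
  have hW := h.finrank_eq.symm.trans hV
  by_cases h1 : 1 ∈ V
  · exact Or.inl (h.conjSub_of_one_mem h2 hV hW h1)
  by_cases ht : ∀ X ∈ V, X.trace = 0
  · -- A traceless plane is the orthogonal complement of a plane containing the identity.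
    have := (h.perp.conjSub_of_one_mem h2 (by rw [finrank_perp, hV]) (by rw [finrank_perp, hW])
      (mem_perp.2 fun X hX => by rw [mul_one, ht X hX])).perp
    rw [perp_perp, perp_perp] at this
    exact Or.inl this
  obtain ⟨B, hBV, hB⟩ := exists_trace_eq_one ht
  obtain ⟨B', hBW, hc⟩ := h.exists_mem hBV
  have hB' := hc.trace_eq.trans hB
  obtain ⟨A, hAV, hA0, hA⟩ := exists_trace_eq_zero hV.ge
  obtain ⟨A', hAW, g, rfl⟩ := h.exists_mem hAV
  by_cases hAd : A.det = 0
  · obtain ⟨k, hk⟩ := exists_conjMap_eq_single hA0 hA hAd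
    have cV : ConjSub V (V.map (conjMap k).toLinearMap) := ⟨k, rfl⟩
    have cW : ConjSub W (W.map (conjMap (k * g⁻¹)).toLinearMap) := ⟨_, rfl⟩
    have hl := (cV.symm.locConjSub.trans h).trans cW.locConjSub
    refine (hl.conjSub_or_of_single_mem (B := conjMap k B) (B' := conjMap (k * g⁻¹) B')
      ?_ ?_ ⟨A, hAV, hk⟩ ⟨_, hAW, ?_⟩
      (by rwa [trace_conjMap]) (by rwa [trace_conjMap]) ⟨B, hBV, rfl⟩ ⟨B', hBW, rfl⟩).imp ?_ ?_
    · rw [finrank_map_conjMap, hV]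
    · rw [finrank_map_conjMap, hW]
    · change conjMap (k * g⁻¹) (conjMap g A) = _
      rw [conjMap_mul, conjMap_inv_conjMap, hk]
    · exact fun hc => (cV.trans hc).trans cW.symm
    · rintro ⟨a, b, h, h'⟩
      exact ⟨a, b, cV.trans h, cW.trans h'⟩
  · have cV : ConjSub V (V.map (conjMap g).toLinearMap) := ⟨g, rfl⟩
    refine Or.inl (cV.trans (LocConjSub.conjSub_of_det_ne_zero (A := conjMap g A)
      (B := conjMap g B) (B' := B') h2 (cV.symm.locConjSub.trans h) ?_ hW ?_
      (by rwa [trace_conjMap]) (by rwa [det_conjMap]) ⟨A, hAV, rfl⟩ hAW (by rwa [trace_conjMap])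
      hB' ⟨B, hBV, rfl⟩ hBW))
    · rw [finrank_map_conjMap, hV]
    · rintro ⟨X, hX, hX1⟩
      have : X = 1 := (conjMap g).injective (by rw [conjMap_one]; exact hX1)
      exact h1 (this ▸ hX)

/-- Over a finite field of odd characteristic, locally conjugate spaces of `2 × 2` matrices are
conjugate or form an exceptional pair. -/
theorem LocConjSub.conjSub_or_exceptionalSub [Finite K] (h2 : (2 : K) ≠ 0)
    {V W : Submodule K (Matrix (Fin 2) (Fin 2) K)} (h : LocConjSub V W) :
    ConjSub V W ∨ ExceptionalSub V W := by
  have hVW := h.finrank_eq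
  have h4 : Module.finrank K (Matrix (Fin 2) (Fin 2) K) = 4 := by
    rw [Module.finrank_matrix]; simp
  have hle : Module.finrank K V ≤ 4 := h4 ▸ V.finrank_le
  have : Module.finrank K V = 0 ∨ Module.finrank K V = 1 ∨ Module.finrank K V = 2 ∨
    Module.finrank K V = 3 ∨ Module.finrank K V = 4 := by omega
  rcases this with hV | hV | hV | hV | hV
  · left
    rw [hV] at hVW
    rw [Submodule.finrank_eq_zero.1 hV, Submodule.finrank_eq_zero.1 hVW.symm]
    exact ⟨1, Submodule.map_bot _⟩
  · exact Or.inl (conjSub_of_finrank_one h hV)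
  · exact h.conjSub_or_of_finrank_two h2 hV
  · have := (conjSub_of_finrank_one h.perp (by rw [finrank_perp, hV])).perp
    rw [perp_perp, perp_perp] at this
    exact Or.inl this
  · left
    rw [hV] at hVW
    rw [Submodule.eq_top_of_finrank_eq (hV.trans h4.symm),
      Submodule.eq_top_of_finrank_eq (hVW.symm.trans h4.symm)]
    exact ⟨1, by rw [Submodule.map_top, LinearEquiv.range]⟩

end Classification

/-! ### Locally conjugate subgroups of a group -/

section Subgroups

variable {G : Type*} [Group G] {H H' H'' : Subgroup G}

theorem LocallyConjugate.symm (h : LocallyConjugate H H') : LocallyConjugate H' H := by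
  obtain ⟨f, hf⟩ := h
  exact ⟨f.symm, fun x => by simpa using (hf (f.symm x)).symm⟩

theorem LocallyConjugate.trans (h : LocallyConjugate H H') (h' : LocallyConjugate H' H'') :
    LocallyConjugate H H'' := by
  obtain ⟨f, hf⟩ := h
  obtain ⟨f', hf'⟩ := h'
  exact ⟨f.trans f', fun x => (hf x).trans (hf' (f x))⟩

theorem LocallyConjugate.exists_mem (h : LocallyConjugate H H') {x : G} (hx : x ∈ H) :
    ∃ y ∈ H', IsConj x y := by
  obtain ⟨f, hf⟩ := h
  exact ⟨f ⟨x, hx⟩, (f ⟨x, hx⟩).2, hf ⟨x, hx⟩⟩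

theorem LocallyConjugate.card_eq (h : LocallyConjugate H H') : Nat.card H = Nat.card H' := by
  obtain ⟨f, -⟩ := h
  exact Nat.card_congr f

theorem ConjugateSubgroups.refl (H : Subgroup G) : ConjugateSubgroups H H :=
  ⟨1, by
    ext x
    simp⟩

theorem ConjugateSubgroups.symm (h : ConjugateSubgroups H H') : ConjugateSubgroups H' H := by
  obtain ⟨g, rfl⟩ := h
  refine ⟨g⁻¹, ?_⟩
  rw [Subgroup.map_map]
  convert Subgroup.map_id H
  ext x
  simp [mul_assoc]

theorem ConjugateSubgroups.trans (h : ConjugateSubgroups H H') (h' : ConjugateSubgroups H' H'') :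
    ConjugateSubgroups H H'' := by
  obtain ⟨g, rfl⟩ := h
  obtain ⟨g', rfl⟩ := h'
  refine ⟨g' * g, ?_⟩
  rw [Subgroup.map_map]
  congr 1
  ext x
  simp [mul_assoc]

theorem ConjugateSubgroups.locallyConjugate (h : ConjugateSubgroups H H') :
    LocallyConjugate H H' := by
  obtain ⟨g, rfl⟩ := h
  exact ⟨(H.equivMapOfInjective _ (MulAut.conj g).injective).toEquiv,
    fun x => isConj_iff.2 ⟨g, rfl⟩⟩

/-- For locally conjugate finite subgroups, an inclusion after conjugation suffices. -/
theorem LocallyConjugate.conjugateSubgroups_of_forall_mem [Finite G] (h : LocallyConjugate H H')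
    (g : G) (hg : ∀ x ∈ H, g * x * g⁻¹ ∈ H') : ConjugateSubgroups H H' := by
  refine ⟨g, Subgroup.eq_of_le_of_card_ge ?_ ?_⟩
  · rintro _ ⟨x, hx, rfl⟩
    exact hg x hx
  · rw [← h.card_eq]
    exact (Nat.card_congr (H.equivMapOfInjective _ (MulAut.conj g).injective).toEquiv).le

theorem LocallyConjugate.conjugateSubgroups_of_le [Finite G] (h : LocallyConjugate H H')
    (hle : H ≤ H') : ConjugateSubgroups H H' :=
  h.conjugateSubgroups_of_forall_mem 1 fun x hx => by simpa using hle hx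

/-- Let `D` be contained in the union of `A`, `B` and `Z`, but not in `Z`. If `D` is contained neither
in `A` nor in `B`, then `A`, `B` and `Z` cut out the three subgroups of index `2` belonging to a Klein
four quotient of `D`, so `D` has an element of `Z` outside `A` whose square is in `A`. -/
theorem exists_of_le_union {D A B Z : Subgroup G} (hcov : ∀ x ∈ D, x ∈ A ∨ x ∈ B ∨ x ∈ Z)
    (hZ : ¬ D ≤ Z) : D ≤ A ∨ D ≤ B ∨ ∃ k ∈ D, k ∈ Z ∧ k ∉ A ∧ k ^ 2 ∈ A := by
  have two : ∀ {X Y : Subgroup G}, ¬ D ≤ X → ¬ D ≤ Y → ∃ x ∈ D, x ∉ X ∧ x ∉ Y := by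
    intro X Y hX hY
    obtain ⟨x, hx, hxX⟩ := SetLike.not_le_iff_exists.1 hX
    obtain ⟨y, hy, hyY⟩ := SetLike.not_le_iff_exists.1 hY
    by_cases hxY : x ∈ Y
    · by_cases hyX : y ∈ X
      · exact ⟨x * y, D.mul_mem hx hy, fun h => hxX ((X.mul_mem_cancel_right hyX).1 h),
          fun h => hyY ((Y.mul_mem_cancel_left hxY).1 h)⟩
      · exact ⟨y, hy, hyX, hyY⟩
    · exact ⟨x, hx, hxX, hxY⟩
  by_cases hA : D ≤ A
  · exact Or.inl hA
  by_cases hB : D ≤ B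
  · exact Or.inr (Or.inl hB)
  refine Or.inr (Or.inr ?_)
  obtain ⟨b, hbD, hbA, hbZ⟩ := two hA hZ
  obtain ⟨a, haD, haB, haZ⟩ := two hB hZ
  have hb : b ∈ B := by have := hcov b hbD; tauto
  have ha : a ∈ A := by have := hcov a haD; tauto
  have kA : a * b ∉ A := fun h => hbA ((A.mul_mem_cancel_left ha).1 h)
  have kB : a * b ∉ B := fun h => haB ((B.mul_mem_cancel_right hb).1 h)
  have kD := D.mul_mem haD hbD
  have kZ : a * b ∈ Z := by have := hcov _ kD; tauto
  have h1 : a * b * a ∈ B := by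
    have := hcov _ (D.mul_mem kD haD)
    have n1 : a * b * a ∉ A := fun h => kA ((A.mul_mem_cancel_right ha).1 h)
    have n2 : a * b * a ∉ Z := fun h => haZ ((Z.mul_mem_cancel_left kZ).1 h)
    tauto
  have h2 : a * b * (a * b * a) ∈ A := by
    have := hcov _ (D.mul_mem kD (D.mul_mem kD haD))
    have n1 : a * b * (a * b * a) ∉ B := fun h => kB ((B.mul_mem_cancel_right h1).1 h)
    have n2 : a * b * (a * b * a) ∉ Z := fun h =>
      haZ ((Z.mul_mem_cancel_left kZ).1 ((Z.mul_mem_cancel_left kZ).1 h))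
    tauto
  rw [← mul_assoc] at h2
  refine ⟨a * b, kD, kZ, kA, ?_⟩
  rw [pow_two]
  exact (A.mul_mem_cancel_right ha).1 h2

end Subgroups

/-! ### Diagonal matrices -/

section Diagonal

variable {R : Type*} [CommRing R]

/-- The invertible diagonal matrix with diagonal entries the units `w` and `z`. -/
def diagGL (w z : Rˣ) : GL (Fin 2) R where
  val := !![(w : R), 0; 0, (z : R)]
  inv := !![((w⁻¹ : Rˣ) : R), 0; 0, ((z⁻¹ : Rˣ) : R)]
  val_inv := by simp [Matrix.one_fin_two]
  inv_val := by simp [Matrix.one_fin_two]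

@[simp] theorem coe_diagGL (w z : Rˣ) :
    (diagGL w z : Matrix (Fin 2) (Fin 2) R) = !![(w : R), 0; 0, (z : R)] := rfl

theorem diagGL_mul (w z w' z' : Rˣ) :
    diagGL w z * diagGL w' z' = diagGL (w * w') (z * z') := by
  ext i j
  simp

theorem diagGL_commute (w z w' z' : Rˣ) :
    diagGL w z * diagGL w' z' = diagGL w' z' * diagGL w z := by
  rw [diagGL_mul, diagGL_mul, mul_comm, mul_comm z]

/-- Scalar matrices are central. -/
theorem diagGL_self_mul (w : Rˣ) (x : GL (Fin 2) R) : diagGL w w * x = x * diagGL w w := by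
  apply Units.ext
  rw [Units.val_mul, Units.val_mul]
  ext i j
  fin_cases i <;> fin_cases j <;> simp [Matrix.mul_apply, Fin.sum_univ_two, mul_comm]

theorem diagGL_pow (w z : Rˣ) (n : ℕ) : diagGL w z ^ n = diagGL (w ^ n) (z ^ n) := by
  induction n with
  | zero =>
    apply Units.ext
    simp [Matrix.one_fin_two]
  | succ n ih => rw [pow_succ, ih, diagGL_mul, pow_succ, pow_succ]

theorem diagGL_self_mem_of_locallyConjugate {H H' : Subgroup (GL (Fin 2) R)}
    (h : LocallyConjugate H H') {w : Rˣ} (hw : diagGL w w ∈ H) :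
    diagGL w w ∈ H' := by
  obtain ⟨y, hy, hc⟩ := h.exists_mem hw
  obtain ⟨c, hc⟩ := isConj_iff.1 hc
  rw [← diagGL_self_mul, mul_inv_cancel_right] at hc
  rwa [hc]

theorem diagGL_mem_cartanSplit (w z : Rˣ) : diagGL w z ∈ cartanSplit R := ⟨w, z, rfl⟩

theorem diagGL_inj {w z w' z' : Rˣ} : diagGL w z = diagGL w' z' ↔ w = w' ∧ z = z' := by
  constructor
  · intro h
    have h' := congrArg Units.val h
    have h0 := congrFun (congrFun h' 0) 0
    have h1 := congrFun (congrFun h' 1) 1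
    exact ⟨Units.ext (by simpa using h0), Units.ext (by simpa using h1)⟩
  · rintro ⟨rfl, rfl⟩
    rfl

theorem exists_eq_diagGL_of_coe_eq {g : GL (Fin 2) R} {w z : R}
    (h : (g : Matrix (Fin 2) (Fin 2) R) = !![w, 0; 0, z]) :
    ∃ w' z' : Rˣ, (w' : R) = w ∧ (z' : R) = z ∧ g = diagGL w' z' := by
  have hu : IsUnit (w * z) := by
    have := (Matrix.isUnit_iff_isUnit_det _).1 g.isUnit
    rwa [h, Matrix.det_fin_two_of, mul_zero, sub_zero] at this
  obtain ⟨w', rfl⟩ := isUnit_of_mul_isUnit_left hu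
  obtain ⟨z', rfl⟩ := isUnit_of_mul_isUnit_right hu
  exact ⟨w', z', rfl, rfl, Units.ext h⟩

theorem mem_cartanSplit_iff {g : GL (Fin 2) R} :
    g ∈ cartanSplit R ↔ ∃ w z : Rˣ, g = diagGL w z := by
  constructor
  · rintro ⟨w, z, h⟩
    obtain ⟨w', z', -, -, h'⟩ := exists_eq_diagGL_of_coe_eq h
    exact ⟨w', z', h'⟩
  · rintro ⟨w, z, rfl⟩
    exact diagGL_mem_cartanSplit w z

/-- The permutation matrix exchanging the two coordinates. -/
def swapGL (R : Type*) [CommRing R] : GL (Fin 2) R where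
  val := !![0, 1; 1, 0]
  inv := !![0, 1; 1, 0]
  val_inv := by simp [Matrix.one_fin_two]
  inv_val := by simp [Matrix.one_fin_two]

theorem swapGL_inv : (swapGL R)⁻¹ = swapGL R := rfl

@[simp] theorem coe_swapGL : (swapGL R : Matrix (Fin 2) (Fin 2) R) = !![0, 1; 1, 0] := rfl

theorem swapGL_mul_diagGL (w z : Rˣ) : swapGL R * diagGL w z * (swapGL R)⁻¹ = diagGL z w := by
  rw [swapGL_inv]
  ext i j
  fin_cases i <;> fin_cases j <;> simp

theorem diagGL_mem_map_swap {H : Subgroup (GL (Fin 2) R)}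
    {w z : Rˣ} :
    diagGL w z ∈ H.map (MulAut.conj (swapGL R)).toMonoidHom ↔ diagGL z w ∈ H := by
  constructor
  · rintro ⟨x, hx, he⟩
    change swapGL _ * x * (swapGL _)⁻¹ = _ at he
    rw [← swapGL_mul_diagGL, mul_left_inj, mul_right_inj] at he
    exact he ▸ hx
  · intro hm
    exact ⟨_, hm, swapGL_mul_diagGL z w⟩

theorem diagonalSwaps_iff {D D' : Subgroup (GL (Fin 2) R)} (hD : D ≤ cartanSplit R)
    (hD' : D' ≤ cartanSplit R) :
    DiagonalSwaps D D' ↔ ∀ w z : Rˣ, diagGL w z ∈ D ↔ diagGL z w ∈ D' := by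
  constructor
  · rintro ⟨-, -, h⟩ w z
    have := h w z
    constructor
    · intro hm
      obtain ⟨g, hg, hgc⟩ := this.1 ⟨_, hm, rfl⟩
      rwa [show diagGL z w = g from Units.ext hgc.symm]
    · intro hm
      obtain ⟨g, hg, hgc⟩ := this.2 ⟨_, hm, rfl⟩
      rwa [show diagGL w z = g from Units.ext hgc.symm]
  · intro h
    refine ⟨hD, hD', fun w z => ⟨?_, ?_⟩⟩
    · rintro ⟨g, hg, hgc⟩
      obtain ⟨w', z', rfl, rfl, rfl⟩ := exists_eq_diagGL_of_coe_eq hgc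
      exact ⟨_, (h _ _).1 hg, rfl⟩
    · rintro ⟨g, hg, hgc⟩
      obtain ⟨w', z', rfl, rfl, rfl⟩ := exists_eq_diagGL_of_coe_eq hgc
      exact ⟨_, (h _ _).2 hg, rfl⟩

end Diagonal

/-! ### The kernel of reduction modulo `p` -/

section Kernel

/-- Reduction of residue classes modulo `p ^ 2` to residue classes modulo `p`. -/
def redZMod (p : ℕ) : ZMod (p ^ 2) →+* ZMod p :=
  ZMod.castHom (dvd_pow_self p two_ne_zero) (ZMod p)

/-- Multiplication by `p`, as an additive map from `ℤ/pℤ` onto the multiples of `p` in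
`ℤ/p²ℤ`. -/
def mulP (p : ℕ) : ZMod p →+ ZMod (p ^ 2) :=
  ZMod.lift p ⟨(AddMonoidHom.mulLeft (p : ZMod (p ^ 2))).comp (Int.castAddHom (ZMod (p ^ 2))), by
    have h : ((p : ℕ) : ZMod (p ^ 2)) * (p : ℕ) = 0 := by
      rw [← Nat.cast_mul, ← pow_two, ZMod.natCast_self]
    simpa using h⟩

variable {p : ℕ}

theorem mulP_intCast (n : ℤ) : mulP p n = p * n := by
  simp [mulP]

theorem redZMod_surjective : Function.Surjective (redZMod p) := fun a => by
  obtain ⟨n, rfl⟩ := ZMod.intCast_surjective a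
  exact ⟨n, map_intCast _ n⟩

theorem mulP_redZMod (r : ZMod (p ^ 2)) : mulP p (redZMod p r) = p * r := by
  obtain ⟨n, rfl⟩ := ZMod.intCast_surjective r
  rw [map_intCast, mulP_intCast]

theorem mulP_mul_redZMod (a : ZMod p) (r : ZMod (p ^ 2)) :
    mulP p (a * redZMod p r) = mulP p a * r := by
  obtain ⟨s, rfl⟩ := redZMod_surjective a
  rw [← map_mul, mulP_redZMod, mulP_redZMod, mul_assoc]

theorem mulP_redZMod_mul (a : ZMod p) (r : ZMod (p ^ 2)) :
    mulP p (redZMod p r * a) = r * mulP p a := by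
  rw [mul_comm, mulP_mul_redZMod, mul_comm]

@[simp] theorem redZMod_mulP (a : ZMod p) : redZMod p (mulP p a) = 0 := by
  obtain ⟨s, rfl⟩ := redZMod_surjective a
  rw [mulP_redZMod, map_mul, map_natCast, ZMod.natCast_self, zero_mul]

@[simp] theorem mulP_mul_mulP (a b : ZMod p) : mulP p a * mulP p b = 0 := by
  rw [← mulP_mul_redZMod, redZMod_mulP, mul_zero, map_zero]

theorem exists_mulP_eq {r : ZMod (p ^ 2)} (hr : redZMod p r = 0) : ∃ a, mulP p a = r := by
  obtain ⟨n, rfl⟩ := ZMod.intCast_surjective r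
  rw [map_intCast, ZMod.intCast_zmod_eq_zero_iff_dvd] at hr
  obtain ⟨m, rfl⟩ := hr
  exact ⟨m, by rw [mulP_intCast]; push_cast; rfl⟩

theorem map_mulP_mul_map_mulP (A B : Matrix (Fin 2) (Fin 2) (ZMod p)) :
    A.map (mulP p) * B.map (mulP p) = 0 := by
  ext i j
  simp [Matrix.mul_apply]

/-- The element `1 + p A` of the kernel of reduction, for a matrix `A` over `ℤ/pℤ`. -/
def onePlusP (A : Matrix (Fin 2) (Fin 2) (ZMod p)) : GL (Fin 2) (ZMod (p ^ 2)) where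
  val := 1 + A.map (mulP p)
  inv := 1 - A.map (mulP p)
  val_inv := by simp [mul_sub, add_mul, map_mulP_mul_map_mulP]
  inv_val := by simp [mul_add, sub_mul, map_mulP_mul_map_mulP]

theorem coe_onePlusP (A : Matrix (Fin 2) (Fin 2) (ZMod p)) :
    (onePlusP A : Matrix (Fin 2) (Fin 2) (ZMod (p ^ 2))) = 1 + A.map (mulP p) := rfl

theorem coe_reductionModP (x : GL (Fin 2) (ZMod (p ^ 2))) :
    (reductionModP p x : Matrix (Fin 2) (Fin 2) (ZMod p)) =
      (x : Matrix (Fin 2) (Fin 2) (ZMod (p ^ 2))).map (redZMod p) := rfl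

variable [Fact p.Prime]

theorem mulP_injective : Function.Injective (mulP p) := by
  rw [injective_iff_map_eq_zero]
  intro a ha
  obtain ⟨n, rfl⟩ := ZMod.intCast_surjective a
  have hp : (p : ℤ) ≠ 0 := by exact_mod_cast (Fact.out : p.Prime).ne_zero
  rw [mulP_intCast, ← Int.cast_natCast, ← Int.cast_mul, ZMod.intCast_zmod_eq_zero_iff_dvd] at ha
  rw [ZMod.intCast_zmod_eq_zero_iff_dvd]
  push_cast at ha
  rw [pow_two] at ha
  exact (mul_dvd_mul_iff_left hp).1 ha

theorem isUnit_of_redZMod_ne_zero {r : ZMod (p ^ 2)} (hr : redZMod p r ≠ 0) : IsUnit r := by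
  obtain ⟨s, hs⟩ := redZMod_surjective (redZMod p r)⁻¹
  obtain ⟨a, ha⟩ := exists_mulP_eq (r := r * s - 1) (by
    rw [map_sub, map_mul, hs, mul_inv_cancel₀ hr, map_one, sub_self])
  refine IsUnit.of_mul_eq_one (s * (1 - mulP p a)) ?_
  have h := mulP_mul_mulP a a
  linear_combination (-1 + mulP p a) * ha - h

theorem redZMod_unit_ne_zero (w : (ZMod (p ^ 2))ˣ) : redZMod p w ≠ 0 :=
  (w.isUnit.map (redZMod p)).ne_zero

theorem onePlusP_add (A B : Matrix (Fin 2) (Fin 2) (ZMod p)) :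
    onePlusP (A + B) = onePlusP A * onePlusP B := by
  apply Units.ext
  rw [Units.val_mul, coe_onePlusP, coe_onePlusP, coe_onePlusP,
    Matrix.map_add _ (map_add (mulP p))]
  simp only [add_mul, mul_add, map_mulP_mul_map_mulP, one_mul, mul_one, add_zero]
  abel

@[simp] theorem onePlusP_zero : onePlusP (0 : Matrix (Fin 2) (Fin 2) (ZMod p)) = 1 := by
  have h := onePlusP_add (0 : Matrix (Fin 2) (Fin 2) (ZMod p)) 0
  rw [add_zero] at h
  exact left_eq_mul.1 h

theorem onePlusP_neg (A : Matrix (Fin 2) (Fin 2) (ZMod p)) : onePlusP (-A) = (onePlusP A)⁻¹ := by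
  rw [eq_inv_iff_mul_eq_one, ← onePlusP_add, neg_add_cancel, onePlusP_zero]

theorem onePlusP_nsmul (n : ℕ) (A : Matrix (Fin 2) (Fin 2) (ZMod p)) :
    onePlusP (n • A) = onePlusP A ^ n := by
  induction n with
  | zero => simp
  | succ n ih => rw [add_smul, one_smul, onePlusP_add, ih]; exact (pow_succ _ _).symm

theorem onePlusP_pow_p (A : Matrix (Fin 2) (Fin 2) (ZMod p)) : onePlusP A ^ p = 1 := by
  rw [← onePlusP_nsmul, ← Nat.cast_smul_eq_nsmul (ZMod p)]
  simp

theorem onePlusP_injective :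
    Function.Injective (onePlusP : Matrix (Fin 2) (Fin 2) (ZMod p) → _) := by
  intro A B h
  have h' := congrArg Units.val h
  rw [coe_onePlusP, coe_onePlusP, add_right_inj] at h'
  exact Matrix.map_injective mulP_injective h'

theorem mul_map_mulP (X : Matrix (Fin 2) (Fin 2) (ZMod (p ^ 2)))
    (A : Matrix (Fin 2) (Fin 2) (ZMod p)) :
    X * A.map (mulP p) = (X.map (redZMod p) * A).map (mulP p) := by
  ext i j
  simp [Matrix.mul_apply, mulP_redZMod_mul]

theorem map_mulP_mul (X : Matrix (Fin 2) (Fin 2) (ZMod (p ^ 2)))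
    (A : Matrix (Fin 2) (Fin 2) (ZMod p)) :
    A.map (mulP p) * X = (A * X.map (redZMod p)).map (mulP p) := by
  ext i j
  simp [Matrix.mul_apply, mulP_mul_redZMod]

theorem conj_onePlusP (x : GL (Fin 2) (ZMod (p ^ 2))) (A : Matrix (Fin 2) (Fin 2) (ZMod p)) :
    x * onePlusP A * x⁻¹ = onePlusP (conjMap (reductionModP p x) A) := by
  rw [mul_inv_eq_iff_eq_mul]
  apply Units.ext
  rw [Units.val_mul, Units.val_mul, coe_onePlusP, coe_onePlusP, mul_add, add_mul, mul_map_mulP,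
    map_mulP_mul, ← coe_reductionModP, conjMap_eq_iff.1 rfl]
  simp

@[simp] theorem reductionModP_onePlusP (A : Matrix (Fin 2) (Fin 2) (ZMod p)) :
    reductionModP p (onePlusP A) = 1 := by
  apply Units.ext
  rw [coe_reductionModP, coe_onePlusP]
  ext i j
  by_cases h : i = j <;> simp [h]

theorem exists_onePlusP_eq {x : GL (Fin 2) (ZMod (p ^ 2))} (hx : reductionModP p x = 1) :
    ∃ A, onePlusP A = x := by
  have h : ∀ i j, redZMod p ((x.val - 1 : Matrix (Fin 2) (Fin 2) (ZMod (p ^ 2))) i j) = 0 := by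
    intro i j
    have hx' : (reductionModP p x).val = 1 := by rw [hx, Units.val_one]
    have := congrFun (congrFun hx' i) j
    rw [coe_reductionModP, Matrix.map_apply] at this
    rw [Matrix.sub_apply, map_sub, this]
    by_cases h : i = j <;> simp [Matrix.one_apply, h]
  choose A hA using fun i j => exists_mulP_eq (h i j)
  refine ⟨Matrix.of A, Units.ext ?_⟩
  have : (Matrix.of A).map (mulP p) = x.val - 1 := by
    ext i j
    exact hA i j
  rw [coe_onePlusP, this, add_sub_cancel]

theorem reductionModP_surjective : Function.Surjective (reductionModP p) := by
  intro g
  choose M hM using fun i j => redZMod_surjective (p := p) (g.val i j)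
  have hMg : (Matrix.of M).map (redZMod p) = g.val := by
    ext i j
    exact hM i j
  have hu : IsUnit (Matrix.of M).det := by
    apply isUnit_of_redZMod_ne_zero
    rw [RingHom.map_det, RingHom.mapMatrix_apply, hMg]
    exact ((Matrix.isUnit_iff_isUnit_det _).1 g.isUnit).ne_zero
  refine ⟨((Matrix.isUnit_iff_isUnit_det _).2 hu).unit, Units.ext ?_⟩
  rw [coe_reductionModP]
  exact hMg

theorem reductionModP_diagGL (w z : (ZMod (p ^ 2))ˣ) :
    reductionModP p (diagGL w z) =
      diagGL (Units.map (redZMod p) w) (Units.map (redZMod p) z) := by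
  apply Units.ext
  rw [coe_reductionModP]
  ext i j
  fin_cases i <;> fin_cases j <;> simp

theorem exists_units_map_eq (u : (ZMod p)ˣ) :
    ∃ w : (ZMod (p ^ 2))ˣ, Units.map (redZMod p) w = u := by
  obtain ⟨r, hr⟩ := redZMod_surjective (p := p) (u : ZMod p)
  obtain ⟨w, rfl⟩ := isUnit_of_redZMod_ne_zero (r := r) (by rw [hr]; exact u.ne_zero)
  exact ⟨w, Units.ext hr⟩

/-- The space of matrices `A` over `ℤ/pℤ` with `1 + p A` in the given subgroup. -/
def kernelSub (H : Subgroup (GL (Fin 2) (ZMod (p ^ 2)))) :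
    Submodule (ZMod p) (Matrix (Fin 2) (Fin 2) (ZMod p)) :=
  AddSubgroup.toZModSubmodule p
    { carrier := {A | onePlusP A ∈ H}
      add_mem' := fun {A B} hA hB => by
        rw [Set.mem_ofPred_eq, onePlusP_add]
        exact H.mul_mem hA hB
      zero_mem' := by
        rw [Set.mem_ofPred_eq, onePlusP_zero]
        exact H.one_mem
      neg_mem' := fun {A} hA => by
        rw [Set.mem_ofPred_eq, onePlusP_neg]
        exact H.inv_mem hA }

theorem mem_kernelSub {H : Subgroup (GL (Fin 2) (ZMod (p ^ 2)))}
    {A : Matrix (Fin 2) (Fin 2) (ZMod p)} : A ∈ kernelSub H ↔ onePlusP A ∈ H := Iff.rfl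

theorem matConj_of_isConj {A B : Matrix (Fin 2) (Fin 2) (ZMod p)}
    (h : IsConj (onePlusP A) (onePlusP B)) : MatConj A B := by
  obtain ⟨c, hc⟩ := isConj_iff.1 h
  rw [conj_onePlusP] at hc
  exact ⟨_, onePlusP_injective hc⟩

/-- Local conjugacy of subgroups restricts to the kernel of reduction. -/
theorem LocallyConjugate.locConjSub_kernelSub {H H' : Subgroup (GL (Fin 2) (ZMod (p ^ 2)))}
    (h : LocallyConjugate H H') : LocConjSub (kernelSub H) (kernelSub H') := by
  obtain ⟨f, hf⟩ := h
  let e : ∀ H : Subgroup (GL (Fin 2) (ZMod (p ^ 2))),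
      kernelSub H ≃ {x : H // reductionModP p x = 1} := fun H =>
    Equiv.ofBijective
      (fun A => ⟨⟨onePlusP A.1, mem_kernelSub.1 A.2⟩, reductionModP_onePlusP A.1⟩) (by
        constructor
        · intro A B hAB
          exact Subtype.ext (onePlusP_injective
            (congrArg (fun y : {x : H // reductionModP p x = 1} => y.1.1) hAB))
        · rintro ⟨⟨x, hx⟩, hx1⟩
          obtain ⟨A, rfl⟩ := exists_onePlusP_eq hx1
          exact ⟨⟨A, hx⟩, rfl⟩)
  have he : ∀ H (A : kernelSub H), ((e H A).1 : GL (Fin 2) (ZMod (p ^ 2))) = onePlusP A.1 :=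
    fun H A => rfl
  have hred : ∀ x : H, reductionModP p x = 1 ↔ reductionModP p (f x) = 1 := by
    intro x
    have hc := (reductionModP p).map_isConj (hf x)
    constructor
    · intro h1
      rw [h1] at hc
      exact isConj_one_right.1 hc
    · intro h1
      rw [h1] at hc
      exact isConj_one_left.1 hc
  refine ⟨(e H).trans ((f.subtypeEquiv hred).trans (e H').symm), fun A => matConj_of_isConj ?_⟩
  rw [← he H, ← he H']
  simp only [Equiv.trans_apply, Equiv.apply_symm_apply]
  exact hf _

end Kernel

/-! ### The groups generated by diagonal matrices and `1 + p E₁₂` -/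

section Adjoin

variable {p : ℕ} [Fact p.Prime]

theorem onePlusE12p_eq : onePlusE12p p = onePlusP !![0, 1; 0, 0] := by
  have h1 : mulP p 1 = p := by simpa using mulP_intCast (p := p) 1
  apply Units.ext
  rw [coe_onePlusP]
  change 1 + (p : ZMod (p ^ 2)) • !![0, 1; 0, 0] = _
  ext i j
  fin_cases i <;> fin_cases j <;> simp [h1]

theorem conjMap_diagGL (w z : (ZMod (p ^ 2))ˣ) (a b c d : ZMod p) :
    conjMap (reductionModP p (diagGL w z)) !![a, b; c, d] =
      !![a, redZMod p w * b * (redZMod p z)⁻¹; redZMod p z * c * (redZMod p w)⁻¹, d] := by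
  have hw := redZMod_unit_ne_zero w
  have hz := redZMod_unit_ne_zero z
  rw [reductionModP_diagGL, conjMap_eq_iff]
  ext i j
  fin_cases i <;> fin_cases j <;> simp [mul_comm, hw, hz]

/-- Multiplication of an element of the kernel of reduction past a diagonal matrix. -/
theorem onePlusP_mul_diagGL (w z : (ZMod (p ^ 2))ˣ) (a b c d : ZMod p) :
    onePlusP !![a, b; c, d] * diagGL w z = diagGL w z *
      onePlusP !![a, redZMod p z * b * (redZMod p w)⁻¹; redZMod p w * c * (redZMod p z)⁻¹, d] := by
  have hw := redZMod_unit_ne_zero w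
  have hz := redZMod_unit_ne_zero z
  rw [mul_inv_eq_iff_eq_mul.1 (conj_onePlusP (diagGL w z) _), conjMap_diagGL]
  congr 2
  ext i j
  fin_cases i <;> fin_cases j <;> simp <;> field_simp

/-- The upper triangular matrices `diag(w, z) (1 + p b E₁₂)`. -/
def IsUpperP (x : GL (Fin 2) (ZMod (p ^ 2))) : Prop :=
  ∃ (w z : (ZMod (p ^ 2))ˣ) (b : ZMod p), x = diagGL w z * onePlusP !![0, b; 0, 0]

theorem upper_mul_upper (w z w' z' : (ZMod (p ^ 2))ˣ) (b b' : ZMod p) :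
    diagGL w z * onePlusP !![0, b; 0, 0] * (diagGL w' z' * onePlusP !![0, b'; 0, 0]) =
      diagGL (w * w') (z * z') *
        onePlusP !![0, redZMod p z' * b * (redZMod p w')⁻¹ + b'; 0, 0] := by
  rw [mul_assoc, ← mul_assoc (onePlusP _), onePlusP_mul_diagGL, mul_assoc, ← mul_assoc (diagGL w z),
    diagGL_mul, ← onePlusP_add]
  congr 2
  ext i j
  fin_cases i <;> fin_cases j <;> simp

theorem onePlusP_upper_eq_pow (b : ZMod p) :
    onePlusP !![0, b; 0, 0] = (onePlusP !![0, (1 : ZMod p); 0, 0]) ^ b.val := by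
  rw [← onePlusP_nsmul, ← Nat.cast_smul_eq_nsmul (ZMod p)]
  congr 1
  ext i j
  fin_cases i <;> fin_cases j <;> simp

theorem mem_adjoin_iff {D : Subgroup (GL (Fin 2) (ZMod (p ^ 2)))}
    (hD : D ≤ cartanSplit (ZMod (p ^ 2))) {x : GL (Fin 2) (ZMod (p ^ 2))} :
    x ∈ adjoinOnePlusE12p p D ↔ ∃ (w z : (ZMod (p ^ 2))ˣ) (b : ZMod p), diagGL w z ∈ D ∧
      x = diagGL w z * onePlusP !![0, b; 0, 0] := by
  have h0 : onePlusP !![0, (0 : ZMod p); 0, 0] = 1 := by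
    rw [← onePlusP_zero]
    congr 1
    ext i j
    fin_cases i <;> fin_cases j <;> simp
  have h1 : diagGL 1 1 = (1 : GL (Fin 2) (ZMod (p ^ 2))) := by
    apply Units.ext
    simp [Matrix.one_fin_two]
  constructor
  · intro hx
    induction hx using Subgroup.closure_induction with
    | mem x hx =>
      rcases hx with hx | hx
      · obtain ⟨w, z, rfl⟩ := mem_cartanSplit_iff.1 (hD hx)
        exact ⟨w, z, 0, hx, by rw [h0, mul_one]⟩
      · rw [Set.mem_singleton_iff] at hx
        exact ⟨1, 1, 1, h1 ▸ D.one_mem, by rw [hx, onePlusE12p_eq, h1, one_mul]⟩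
    | one => exact ⟨1, 1, 0, h1 ▸ D.one_mem, by rw [h0, h1, mul_one]⟩
    | mul x y _ _ hx hy =>
      obtain ⟨w, z, b, hd, rfl⟩ := hx
      obtain ⟨w', z', b', hd', rfl⟩ := hy
      exact ⟨w * w', z * z', _, by rw [← diagGL_mul]; exact D.mul_mem hd hd',
        upper_mul_upper _ _ _ _ _ _⟩
    | inv x _ hx =>
      obtain ⟨w, z, b, hd, rfl⟩ := hx
      refine ⟨w⁻¹, z⁻¹, -(redZMod p ↑z⁻¹ * b * (redZMod p ↑w⁻¹)⁻¹), D.inv_mem hd, ?_⟩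
      rw [inv_eq_iff_mul_eq_one, upper_mul_upper, add_neg_cancel, h0, mul_inv_cancel,
        mul_inv_cancel, h1, mul_one]
  · rintro ⟨w, z, b, hd, rfl⟩
    refine Subgroup.mul_mem _ (Subgroup.subset_closure (Or.inl hd)) ?_
    rw [onePlusP_upper_eq_pow, ← onePlusE12p_eq]
    have hT : onePlusE12p p ∈ adjoinOnePlusE12p p D := Subgroup.subset_closure (Or.inr rfl)
    exact pow_mem hT _

/-- A group of upper triangular matrices containing `1 + p E₁₂` is generated by that element and
the diagonal matrices it contains. -/
theorem eq_adjoin_of_isUpperP {H : Subgroup (GL (Fin 2) (ZMod (p ^ 2)))}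
    (hT : onePlusP !![0, 1; 0, 0] ∈ H) (hH : ∀ x ∈ H, IsUpperP x) :
    H = adjoinOnePlusE12p p (H ⊓ cartanSplit (ZMod (p ^ 2))) := by
  ext x
  rw [mem_adjoin_iff inf_le_right]
  constructor
  · intro hx
    obtain ⟨w, z, b, rfl⟩ := hH x hx
    refine ⟨w, z, b, ⟨?_, diagGL_mem_cartanSplit w z⟩, rfl⟩
    refine (H.mul_mem_cancel_right ?_).1 hx
    rw [onePlusP_upper_eq_pow]
    exact H.pow_mem hT _
  · rintro ⟨w, z, b, hd, rfl⟩
    refine H.mul_mem hd.1 ?_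
    rw [onePlusP_upper_eq_pow]
    exact H.pow_mem hT _

/-- Reflection of a matrix in its antidiagonal. It is conjugation of the transpose by `swapGL`. -/
def antiTranspose {R : Type*} [CommRing R] (x : GL (Fin 2) R) : GL (Fin 2) R where
  val := !![x.val 1 1, x.val 0 1; x.val 1 0, x.val 0 0]
  inv := !![x.inv 1 1, x.inv 0 1; x.inv 1 0, x.inv 0 0]
  val_inv := by
    have h : ∀ i j, (x.inv * x.val) i j = (1 : Matrix (Fin 2) (Fin 2) R) i j := fun i j => by
      rw [x.inv_val]
    simp only [Matrix.mul_apply, Fin.sum_univ_two] at h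
    ext i j
    fin_cases i <;> fin_cases j <;> simp [Fin.sum_univ_two, Matrix.mul_apply]
    · have := h 1 1; simp at this; linear_combination this
    · have := h 0 1; simp at this; linear_combination this
    · have := h 1 0; simp at this; linear_combination this
    · have := h 0 0; simp at this; linear_combination this
  inv_val := by
    have h : ∀ i j, (x.val * x.inv) i j = (1 : Matrix (Fin 2) (Fin 2) R) i j := fun i j => by
      rw [x.val_inv]
    simp only [Matrix.mul_apply, Fin.sum_univ_two] at h
    ext i j
    fin_cases i <;> fin_cases j <;> simp [Fin.sum_univ_two, Matrix.mul_apply]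
    · have := h 1 1; simp at this; linear_combination this
    · have := h 0 1; simp at this; linear_combination this
    · have := h 1 0; simp at this; linear_combination this
    · have := h 0 0; simp at this; linear_combination this

theorem antiTranspose_antiTranspose {R : Type*} [CommRing R] (x : GL (Fin 2) R) :
    antiTranspose (antiTranspose x) = x := by
  apply Units.ext
  ext i j
  fin_cases i <;> fin_cases j <;> rfl

theorem coe_upper (w z : (ZMod (p ^ 2))ˣ) (b : ZMod p) :
    (diagGL w z * onePlusP !![0, b; 0, 0]).val =
      !![(w : ZMod (p ^ 2)), (w : ZMod (p ^ 2)) * mulP p b; 0, (z : ZMod (p ^ 2))] := by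
  rw [Units.val_mul, coe_onePlusP]
  ext i j
  fin_cases i <;> fin_cases j <;> simp [Matrix.mul_apply, Fin.sum_univ_two]

theorem antiTranspose_upper (w z : (ZMod (p ^ 2))ˣ) (b : ZMod p) :
    antiTranspose (diagGL w z * onePlusP !![0, b; 0, 0]) =
      diagGL z w * onePlusP !![0, redZMod p w * b * (redZMod p z)⁻¹; 0, 0] := by
  have hz := redZMod_unit_ne_zero z
  apply Units.ext
  rw [coe_upper, ← mulP_redZMod_mul, mul_comm, inv_mul_cancel_right₀ hz, mulP_redZMod_mul]
  change !![_, _; _, _] = _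
  rw [coe_upper]
  rfl

theorem isConj_antiTranspose (w z : (ZMod (p ^ 2))ˣ) (b : ZMod p) :
    IsConj (diagGL w z * onePlusP !![0, b; 0, 0])
      (antiTranspose (diagGL w z * onePlusP !![0, b; 0, 0])) := by
  -- One of `w * p b` and `w - z` divides the other, as `ℤ/p²ℤ` is a valuation ring.
  have key : (∃ r, (w : ZMod (p ^ 2)) * mulP p b = (w - z) * r) ∨
      ∃ r, (w - z : ZMod (p ^ 2)) = w * mulP p b * r := by
    by_cases h : redZMod p ((w : ZMod (p ^ 2)) - z) = 0
    · obtain ⟨d, hd⟩ := exists_mulP_eq h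
      by_cases hd0 : d = 0
      · exact Or.inr ⟨0, by rw [← hd, hd0, map_zero, mul_zero]⟩
      · left
        obtain ⟨r, hr⟩ := redZMod_surjective (p := p) (redZMod p w * b / d)
        refine ⟨r, ?_⟩
        rw [← hd, ← mulP_mul_redZMod, hr, mul_div_cancel₀ _ hd0, mulP_redZMod_mul]
    · obtain ⟨u, hu⟩ := isUnit_of_redZMod_ne_zero h
      exact Or.inl ⟨↑u⁻¹ * (w * mulP p b), by rw [← hu, Units.mul_inv_cancel_left]⟩
  have conj : ∀ M : Matrix (Fin 2) (Fin 2) (ZMod (p ^ 2)), M.det = 1 →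
      M * !![(w : ZMod (p ^ 2)), (w : ZMod (p ^ 2)) * mulP p b; 0, (z : ZMod (p ^ 2))] =
        !![(z : ZMod (p ^ 2)), (w : ZMod (p ^ 2)) * mulP p b; 0, (w : ZMod (p ^ 2))] * M →
      IsConj (diagGL w z * onePlusP !![0, b; 0, 0])
        (antiTranspose (diagGL w z * onePlusP !![0, b; 0, 0])) := by
    intro M hM h
    have hu : IsUnit M := (Matrix.isUnit_iff_isUnit_det _).2 (hM ▸ isUnit_one)
    refine isConj_iff.2 ⟨hu.unit, ?_⟩
    rw [mul_inv_eq_iff_eq_mul]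
    apply Units.ext
    rw [Units.val_mul hu.unit, Units.val_mul _ hu.unit, coe_upper]
    change M * _ = !![_, _; _, _] * M
    rw [coe_upper]
    exact h
  rcases key with ⟨r, hr⟩ | ⟨r, hr⟩
  · refine conj !![r, r ^ 2 - 1; 1, r] (by rw [Matrix.det_fin_two_of]; ring) ?_
    rw [hr]
    ext i j
    fin_cases i <;> fin_cases j <;> simp <;> ring
  · refine conj !![1, 0; r, 1] (by rw [Matrix.det_fin_two_of]; ring) ?_
    ext i j
    fin_cases i <;> fin_cases j <;> simp
    · linear_combination hr
    · ring
    · linear_combination -hr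

theorem locallyConjugate_adjoin {D D' : Subgroup (GL (Fin 2) (ZMod (p ^ 2)))}
    (hD : D ≤ cartanSplit (ZMod (p ^ 2))) (hD' : D' ≤ cartanSplit (ZMod (p ^ 2)))
    (h : ∀ w z : (ZMod (p ^ 2))ˣ, diagGL w z ∈ D ↔ diagGL z w ∈ D') :
    LocallyConjugate (adjoinOnePlusE12p p D) (adjoinOnePlusE12p p D') := by
  let e : GL (Fin 2) (ZMod (p ^ 2)) ≃ GL (Fin 2) (ZMod (p ^ 2)) :=
    ⟨antiTranspose, antiTranspose, antiTranspose_antiTranspose, antiTranspose_antiTranspose⟩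
  refine ⟨e.subtypeEquiv fun x => ⟨fun hx => ?_, fun hx => ?_⟩, fun x => ?_⟩
  · obtain ⟨w, z, b, hd, rfl⟩ := (mem_adjoin_iff hD).1 hx
    exact (mem_adjoin_iff hD').2 ⟨z, w, _, (h _ _).1 hd, antiTranspose_upper w z b⟩
  · obtain ⟨w, z, b, hd, hy⟩ := (mem_adjoin_iff hD').1 hx
    exact (mem_adjoin_iff hD).2 ⟨z, w, _, (h _ _).2 hd, by
      rw [← antiTranspose_upper, ← hy]
      exact (antiTranspose_antiTranspose x).symm⟩
  · obtain ⟨x, hx⟩ := x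
    obtain ⟨w, z, b, hd, rfl⟩ := (mem_adjoin_iff hD).1 hx
    exact isConj_antiTranspose w z b

/-- A matrix conjugating `⟨D, 1 + p E₁₂⟩` to `⟨D', 1 + p E₁₂⟩` is upper triangular modulo `p`, and
so preserves diagonal entries. -/
theorem le_of_conjugateSubgroups_adjoin {D D' : Subgroup (GL (Fin 2) (ZMod (p ^ 2)))}
    (hD : D ≤ cartanSplit (ZMod (p ^ 2))) (hD' : D' ≤ cartanSplit (ZMod (p ^ 2)))
    (h : ConjugateSubgroups (adjoinOnePlusE12p p D) (adjoinOnePlusE12p p D')) : D ≤ D' := by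
  obtain ⟨g, hg⟩ := h
  have hmem : ∀ x ∈ adjoinOnePlusE12p p D, g * x * g⁻¹ ∈ adjoinOnePlusE12p p D' := fun x hx =>
    hg ▸ ⟨x, hx, rfl⟩
  have h10 : redZMod p (g.val 1 0) = 0 := by
    have hT := hmem _ (Subgroup.subset_closure (Or.inr rfl))
    obtain ⟨w, z, b, -, hT⟩ := (mem_adjoin_iff hD').1 hT
    rw [onePlusE12p_eq, conj_onePlusP] at hT
    set M := conjMap (reductionModP p g) !![0, 1; 0, 0] with hM
    have hM10 : M 1 0 = 0 := by
      have := congrArg (fun x : GL (Fin 2) (ZMod (p ^ 2)) => x.val 1 0) hT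
      simp only [coe_upper, coe_onePlusP] at this
      apply mulP_injective
      simpa using this
    have hMg := conjMap_eq_iff.1 hM.symm
    have e0 := congrFun (congrFun hMg 1) 0
    have e1 := congrFun (congrFun hMg 1) 1
    rw [coe_reductionModP] at e0 e1
    simp [Matrix.mul_apply, Fin.sum_univ_two, hM10] at e0 e1
    rcases e0 with e0 | e0
    · rw [e1, e0, zero_mul]
    · exact e0
  obtain ⟨c, hc⟩ := exists_mulP_eq h10
  have hdet : redZMod p (g.val 0 0) * redZMod p (g.val 1 1) ≠ 0 := by
    have hu := ((Matrix.isUnit_iff_isUnit_det _).1 g.isUnit).map (redZMod p)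
    rw [Matrix.det_fin_two, map_sub, map_mul, map_mul, h10, mul_zero, sub_zero] at hu
    exact hu.ne_zero
  have h00 := isUnit_of_redZMod_ne_zero (left_ne_zero_of_mul hdet)
  have h11 := isUnit_of_redZMod_ne_zero (right_ne_zero_of_mul hdet)
  intro x hx
  obtain ⟨w, z, rfl⟩ := mem_cartanSplit_iff.1 (hD hx)
  obtain ⟨w', z', b, hd, hy⟩ := (mem_adjoin_iff hD').1
    (hmem _ (Subgroup.subset_closure (Or.inl hx)))
  rw [mul_inv_eq_iff_eq_mul] at hy
  have hy' := congrArg Units.val hy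
  rw [Units.val_mul, Units.val_mul, coe_upper] at hy'
  have e0 := congrFun (congrFun hy' 0) 0
  have e1 := congrFun (congrFun hy' 1) 1
  simp [Matrix.mul_apply, Fin.sum_univ_two, ← hc, mul_assoc] at e0 e1
  rw [mul_comm, h00.mul_left_inj, Units.val_inj] at e0
  rw [mul_comm, h11.mul_left_inj, Units.val_inj] at e1
  rwa [e0, e1]

end Adjoin

/-! ### Exceptional pairs, and subgroups that are scalar modulo `p` -/

section Exceptional

variable {p : ℕ} [Fact p.Prime]

/-- Pairs of subgroups which, up to conjugacy, consist of upper triangular matrices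
`diag(w, z) (1 + p b E₁₂)`, contain `1 + p E₁₂`, and have diagonal parts that are swaps of each
other. -/
def ExceptionalPair (H H' : Subgroup (GL (Fin 2) (ZMod (p ^ 2)))) : Prop :=
  ∃ J J' : Subgroup (GL (Fin 2) (ZMod (p ^ 2))), ConjugateSubgroups H J ∧
    ConjugateSubgroups H' J' ∧ (onePlusP !![0, 1; 0, 0] ∈ J ∧ ∀ x ∈ J, IsUpperP x) ∧
    (onePlusP !![0, 1; 0, 0] ∈ J' ∧ ∀ x ∈ J', IsUpperP x) ∧
    ∀ w z : (ZMod (p ^ 2))ˣ, diagGL w z ∈ J ↔ diagGL z w ∈ J'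

theorem ExceptionalPair.symm {H H' : Subgroup (GL (Fin 2) (ZMod (p ^ 2)))}
    (h : ExceptionalPair H H') : ExceptionalPair H' H := by
  obtain ⟨J, J', h1, h2, h3, h4, h5⟩ := h
  exact ⟨J', J, h2, h1, h4, h3, fun w z => (h5 z w).symm⟩

theorem ExceptionalPair.of_conj {H H' J J' : Subgroup (GL (Fin 2) (ZMod (p ^ 2)))}
    (hJ : ConjugateSubgroups H J) (hJ' : ConjugateSubgroups H' J')
    (h : ExceptionalPair J J') : ExceptionalPair H H' := by
  obtain ⟨I, I', h1, h2, h3, h4, h5⟩ := h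
  exact ⟨I, I', hJ.trans h1, hJ'.trans h2, h3, h4, h5⟩

/-- An element that is scalar modulo `p` is the product of a scalar matrix and an element of the
kernel of reduction, both of them in every subgroup containing the element. -/
theorem exists_scalar_mul_onePlusP {H : Subgroup (GL (Fin 2) (ZMod (p ^ 2)))}
    {x : GL (Fin 2) (ZMod (p ^ 2))} (hx : x ∈ H) {u : (ZMod p)ˣ}
    (hu : reductionModP p x = diagGL u u) :
    ∃ (w : (ZMod (p ^ 2))ˣ) (A : Matrix (Fin 2) (Fin 2) (ZMod p)), diagGL w w ∈ H ∧
      A ∈ kernelSub H ∧ x = diagGL w w * onePlusP A := by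
  obtain ⟨w, hwu⟩ := exists_units_map_eq u
  obtain ⟨A, hA⟩ := exists_onePlusP_eq (x := (diagGL w w)⁻¹ * x) (by
    rw [map_mul, map_inv, reductionModP_diagGL, hu, hwu, inv_mul_cancel])
  rw [eq_inv_mul_iff_mul_eq] at hA
  -- The `p`-th power of `x` is scalar, and by Fermat's little theorem congruent to `x`.
  have hpow : x ^ p = diagGL (w ^ p) (w ^ p) := by
    rw [← hA, (show Commute _ _ from diagGL_self_mul w _).mul_pow, onePlusP_pow_p, mul_one,
      diagGL_pow]
  have hmem : diagGL (w ^ p) (w ^ p) ∈ H := hpow ▸ H.pow_mem hx p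
  have hup : u ^ p = u := Units.ext (by rw [Units.val_pow_eq_pow_val, ZMod.pow_card])
  obtain ⟨B, hB⟩ := exists_onePlusP_eq (x := (diagGL (w ^ p) (w ^ p))⁻¹ * x) (by
    rw [map_mul, map_inv, reductionModP_diagGL, hu, map_pow, hwu, hup, inv_mul_cancel])
  refine ⟨w ^ p, B, hmem, ?_, by rw [hB, mul_inv_cancel_left]⟩
  rw [mem_kernelSub, hB]
  exact H.mul_mem (H.inv_mem hmem) hx

theorem kernelSub_map_conj (H : Subgroup (GL (Fin 2) (ZMod (p ^ 2))))
    (g : GL (Fin 2) (ZMod (p ^ 2))) :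
    kernelSub (H.map (MulAut.conj g).toMonoidHom) =
      (kernelSub H).map (conjMap (reductionModP p g)).toLinearMap := by
  ext A
  rw [Submodule.mem_map_equiv, mem_kernelSub, mem_kernelSub, Subgroup.mem_map_equiv]
  obtain ⟨B, rfl⟩ := (conjMap (reductionModP p g)).surjective A
  rw [LinearEquiv.symm_apply_apply, ← conj_onePlusP, MulAut.conj_symm_apply]
  simp only [mul_assoc, inv_mul_cancel, mul_one, inv_mul_cancel_left]

theorem exists_diagGL_eq_onePlusP (a b : ZMod p) :
    ∃ w z : (ZMod (p ^ 2))ˣ, onePlusP !![a, 0; 0, b] = diagGL w z := by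
  refine mem_cartanSplit_iff.1 ⟨1 + mulP p a, 1 + mulP p b, ?_⟩
  rw [coe_onePlusP]
  ext i j
  fin_cases i <;> fin_cases j <;> simp

theorem conjMap_swapGL (a b c d : ZMod p) :
    conjMap (reductionModP p (swapGL (ZMod (p ^ 2)))) !![a, b; c, d] = !![d, c; b, a] := by
  rw [conjMap_eq_iff, coe_reductionModP]
  ext i j
  fin_cases i <;> fin_cases j <;> simp [Matrix.mul_apply, Fin.sum_univ_two]

/-- If the kernel part is spanned by `E₁₂` and a diagonal matrix, a group that is scalar modulo `p`
consists of upper triangular matrices. -/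
theorem isUpperP_of_kernelSub_eq {H : Subgroup (GL (Fin 2) (ZMod (p ^ 2)))}
    (hH : ∀ x ∈ H, ∃ u : (ZMod p)ˣ, reductionModP p x = diagGL u u) {a b : ZMod p}
    (hV : kernelSub H = Submodule.span (ZMod p) {!![0, 1; 0, 0], !![a, 0; 0, b]}) :
    onePlusP !![0, 1; 0, 0] ∈ H ∧ ∀ x ∈ H, IsUpperP x := by
  constructor
  · rw [← mem_kernelSub, hV]
    exact Submodule.subset_span (Or.inl rfl)
  · intro x hx
    obtain ⟨u, hu⟩ := hH x hx
    obtain ⟨w, A, -, hA, rfl⟩ := exists_scalar_mul_onePlusP hx hu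
    rw [hV, Submodule.mem_span_pair] at hA
    obtain ⟨s, t, rfl⟩ := hA
    obtain ⟨w', z', h'⟩ := exists_diagGL_eq_onePlusP (t * a) (t * b)
    refine ⟨w * w', w * z', s, ?_⟩
    rw [← diagGL_mul, ← h', mul_assoc, ← onePlusP_add]
    congr 2
    ext i j
    fin_cases i <;> fin_cases j <;> simp

theorem diagGL_swap_mem_of_kernelSub_eq {H H' : Subgroup (GL (Fin 2) (ZMod (p ^ 2)))}
    (h : LocallyConjugate H H')
    (hH : ∀ x ∈ H, ∃ u : (ZMod p)ˣ, reductionModP p x = diagGL u u) {a b : ZMod p}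
    (hV : kernelSub H = Submodule.span (ZMod p) {!![0, 1; 0, 0], !![a, 0; 0, b]})
    (hV' : kernelSub H' = Submodule.span (ZMod p) {!![0, 1; 0, 0], !![b, 0; 0, a]})
    {w z : (ZMod (p ^ 2))ˣ} (hm : diagGL w z ∈ H) : diagGL z w ∈ H' := by
  obtain ⟨u, hu⟩ := hH _ hm
  obtain ⟨v, A, hv, hA, he⟩ := exists_scalar_mul_onePlusP hm hu
  rw [hV, Submodule.mem_span_pair] at hA
  obtain ⟨s, t, rfl⟩ := hA
  have hs : s = 0 := by
    have e := congrArg (fun x : GL (Fin 2) (ZMod (p ^ 2)) => x.val 0 1) he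
    rw [coe_diagGL, Units.val_mul, coe_onePlusP] at e
    simp [Matrix.mul_apply, Fin.sum_univ_two] at e
    exact mulP_injective (by rw [map_zero, (Units.mul_right_eq_zero v).1 e.symm])
  rw [← swapGL_mul_diagGL, he, ← mul_assoc, ← diagGL_self_mul, mul_assoc, mul_assoc, ← mul_assoc _ _
    (swapGL _)⁻¹, conj_onePlusP, hs, zero_smul, zero_add, map_smul, conjMap_swapGL]
  refine H'.mul_mem (diagGL_self_mem_of_locallyConjugate h hv) ?_
  rw [← mem_kernelSub, hV']
  exact Submodule.smul_mem _ _ (Submodule.subset_span (Or.inr rfl))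

/-- Locally conjugate subgroups that are scalar modulo `p` are conjugate or exceptional. -/
theorem LocallyConjugate.conjugate_or_exceptional_of_scalar (h2 : (2 : ZMod p) ≠ 0)
    {H H' : Subgroup (GL (Fin 2) (ZMod (p ^ 2)))} (h : LocallyConjugate H H')
    (hH : ∀ x ∈ H, ∃ u : (ZMod p)ˣ, reductionModP p x = diagGL u u)
    (hH' : ∀ x ∈ H', ∃ u : (ZMod p)ˣ, reductionModP p x = diagGL u u) :
    ConjugateSubgroups H H' ∨ ExceptionalPair H H' := by
  have lift : ∀ {H : Subgroup (GL (Fin 2) (ZMod (p ^ 2)))}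
      {V : Submodule (ZMod p) (Matrix (Fin 2) (Fin 2) (ZMod p))}, ConjSub (kernelSub H) V →
      (∀ x ∈ H, ∃ u : (ZMod p)ˣ, reductionModP p x = diagGL u u) →
      ∃ J, ConjugateSubgroups H J ∧ kernelSub J = V ∧
        ∀ x ∈ J, ∃ u : (ZMod p)ˣ, reductionModP p x = diagGL u u := by
    rintro H V ⟨g, hg⟩ hH
    obtain ⟨g, rfl⟩ := reductionModP_surjective g
    refine ⟨_, ⟨g, rfl⟩, by rw [kernelSub_map_conj, hg], ?_⟩
    rintro _ ⟨x, hx, rfl⟩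
    obtain ⟨u, hu⟩ := hH x hx
    refine ⟨u, ?_⟩
    change reductionModP p (g * x * g⁻¹) = _
    rw [map_mul, map_mul, hu, map_inv, mul_inv_eq_iff_eq_mul]
    apply Units.ext
    rw [Units.val_mul, Units.val_mul]
    ext i j
    fin_cases i <;> fin_cases j <;> simp [Matrix.mul_apply, Fin.sum_univ_two, mul_comm]
  rcases h.locConjSub_kernelSub.conjSub_or_exceptionalSub h2 with hc | ⟨a, b, hV, hV'⟩
  · left
    obtain ⟨J, hJ, hker, hJs⟩ := lift hc hH
    have hJH' := hJ.symm.locallyConjugate.trans h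
    refine hJ.trans (hJH'.conjugateSubgroups_of_le fun x hx => ?_)
    obtain ⟨u, hu⟩ := hJs x hx
    obtain ⟨w, A, hw, hA, rfl⟩ := exists_scalar_mul_onePlusP hx hu
    exact H'.mul_mem (diagGL_self_mem_of_locallyConjugate hJH' hw)
      (mem_kernelSub.1 (hker ▸ hA))
  · right
    obtain ⟨J, hJ, hker, hJs⟩ := lift hV hH
    obtain ⟨J', hJ', hker', hJs'⟩ := lift hV' hH'
    have hl := (hJ.symm.locallyConjugate.trans h).trans hJ'.locallyConjugate
    exact ⟨J, J', hJ, hJ', isUpperP_of_kernelSub_eq hJs hker, isUpperP_of_kernelSub_eq hJs' hker',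
      fun w z => ⟨diagGL_swap_mem_of_kernelSub_eq hl hJs hker hker',
        diagGL_swap_mem_of_kernelSub_eq hl.symm hJs' hker' hker⟩⟩

end Exceptional

/-! ### Subgroups that are diagonal but not scalar modulo `p` -/

section Diagonalizable

variable {p : ℕ} [Fact p.Prime]

theorem redZMod_eq_of_map_eq {w z : (ZMod (p ^ 2))ˣ} :
    Units.map (redZMod p : ZMod (p ^ 2) →* ZMod p) w =
      Units.map (redZMod p : ZMod (p ^ 2) →* ZMod p) z ↔ redZMod p w = redZMod p z := by
  rw [Units.ext_iff]
  rfl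

/-- A matrix that is diagonal modulo `p` is the product of a diagonal matrix and some `1 + p A`
with `A` antidiagonal. -/
theorem exists_diagGL_mul_onePlusP {x : GL (Fin 2) (ZMod (p ^ 2))}
    (hx : reductionModP p x ∈ cartanSplit (ZMod p)) :
    ∃ (w z : (ZMod (p ^ 2))ˣ) (b c : ZMod p), x = diagGL w z * onePlusP !![0, b; c, 0] := by
  obtain ⟨u, v, huv⟩ := mem_cartanSplit_iff.1 hx
  obtain ⟨w, rfl⟩ := exists_units_map_eq u
  obtain ⟨z, rfl⟩ := exists_units_map_eq v
  obtain ⟨A, hA⟩ := exists_onePlusP_eq (x := (diagGL w z)⁻¹ * x) (by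
    rw [map_mul, map_inv, reductionModP_diagGL, huv, inv_mul_cancel])
  rw [eq_inv_mul_iff_mul_eq] at hA
  obtain ⟨w', z', h'⟩ := exists_diagGL_eq_onePlusP (A 0 0) (A 1 1)
  refine ⟨w * w', z * z', A 0 1, A 1 0, ?_⟩
  rw [← hA, ← diagGL_mul, ← h', mul_assoc, ← onePlusP_add]
  congr 2
  ext i j
  fin_cases i <;> fin_cases j <;> simp

/-- Conjugation of `diag(w, z) (1 + p A)`, for antidiagonal `A`, by `1 + p B`, for
antidiagonal `B`. -/
theorem onePlusP_conj_diagGL_mul (w z : (ZMod (p ^ 2))ˣ) (b c x y : ZMod p) :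
    onePlusP !![0, x; y, 0] * (diagGL w z * onePlusP !![0, b; c, 0]) *
        (onePlusP !![0, x; y, 0])⁻¹ =
      diagGL w z * onePlusP !![0, redZMod p z * x * (redZMod p w)⁻¹ + b - x;
        redZMod p w * y * (redZMod p z)⁻¹ + c - y, 0] := by
  rw [← mul_assoc, onePlusP_mul_diagGL, mul_assoc, mul_assoc, ← onePlusP_neg, ← onePlusP_add,
    ← onePlusP_add]
  congr 2
  ext i j
  fin_cases i <;> fin_cases j <;> simp <;> ring

/-- A matrix that is diagonal with distinct entries modulo `p` is diagonalized by an element of the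
kernel of reduction. -/
theorem exists_onePlusP_conj_eq_diagGL {w z : (ZMod (p ^ 2))ˣ}
    (h : redZMod p w ≠ redZMod p z) (b c : ZMod p) :
    ∃ A : Matrix (Fin 2) (Fin 2) (ZMod p),
      onePlusP A * (diagGL w z * onePlusP !![0, b; c, 0]) * (onePlusP A)⁻¹ = diagGL w z := by
  have hw := redZMod_unit_ne_zero w
  have hz := redZMod_unit_ne_zero z
  have h1 := sub_ne_zero.2 h
  have h2 := sub_ne_zero.2 h.symm
  refine ⟨!![0, b * redZMod p w / (redZMod p w - redZMod p z);
    c * redZMod p z / (redZMod p z - redZMod p w), 0], ?_⟩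
  rw [onePlusP_conj_diagGL_mul]
  refine mul_eq_left.2 ?_
  rw [← onePlusP_zero]
  congr 1
  ext i j
  fin_cases i <;> fin_cases j <;> simp
  · field_simp
    ring
  · field_simp
    ring

/-- A subgroup whose elements are diagonal modulo `p`, and which contains a diagonal matrix with
entries distinct modulo `p`. -/
def IsFramed (H : Subgroup (GL (Fin 2) (ZMod (p ^ 2)))) : Prop :=
  (∀ x ∈ H, reductionModP p x ∈ cartanSplit (ZMod p)) ∧
    ∃ w z : (ZMod (p ^ 2))ˣ, diagGL w z ∈ H ∧ redZMod p w ≠ redZMod p z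

theorem exists_isFramed {H : Subgroup (GL (Fin 2) (ZMod (p ^ 2)))}
    (hH : ∀ x ∈ H, reductionModP p x ∈ cartanSplit (ZMod p)) {x : GL (Fin 2) (ZMod (p ^ 2))}
    (hx : x ∈ H) (hns : ¬ ∃ u : (ZMod p)ˣ, reductionModP p x = diagGL u u) :
    ∃ J, ConjugateSubgroups H J ∧ IsFramed J := by
  obtain ⟨w, z, b, c, rfl⟩ := exists_diagGL_mul_onePlusP (hH x hx)
  have hwz : redZMod p w ≠ redZMod p z := by
    intro h
    refine hns ⟨Units.map (redZMod p : ZMod (p ^ 2) →* ZMod p) w, ?_⟩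
    rw [map_mul, reductionModP_onePlusP, mul_one, reductionModP_diagGL]
    exact diagGL_inj.2 ⟨rfl, (redZMod_eq_of_map_eq.2 h).symm⟩
  obtain ⟨A, hA⟩ := exists_onePlusP_conj_eq_diagGL hwz b c
  refine ⟨_, ⟨onePlusP A, rfl⟩, ?_, w, z, ⟨_, hx, hA⟩, hwz⟩
  rintro _ ⟨y, hy, rfl⟩
  change reductionModP p (onePlusP A * y * (onePlusP A)⁻¹) ∈ _
  rw [map_mul, map_mul, map_inv, reductionModP_onePlusP, inv_one, mul_one, one_mul]
  exact hH y hy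

/-- A framed subgroup contains the diagonal factors of its elements: the commutator with the framing
element acts on antidiagonal matrices by an operator of order dividing `p - 1`. -/
theorem IsFramed.diagGL_mem {H : Subgroup (GL (Fin 2) (ZMod (p ^ 2)))} (hH : IsFramed H)
    {w z : (ZMod (p ^ 2))ˣ} {b c : ZMod p} (hx : diagGL w z * onePlusP !![0, b; c, 0] ∈ H) :
    diagGL w z ∈ H := by
  obtain ⟨-, u, v, huv, hne⟩ := hH
  have hu := redZMod_unit_ne_zero u
  have hv := redZMod_unit_ne_zero v
  set m := redZMod p u * (redZMod p v)⁻¹ - 1 with hm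
  set n := redZMod p v * (redZMod p u)⁻¹ - 1 with hn
  have step : ∀ {w z : (ZMod (p ^ 2))ˣ} {b c : ZMod p},
      diagGL w z * onePlusP !![0, b; c, 0] ∈ H → onePlusP !![0, m * b; n * c, 0] ∈ H := by
    intro w z b c hx
    have h1 := H.mul_mem (H.inv_mem hx) (H.mul_mem (H.mul_mem huv hx) (H.inv_mem huv))
    have h2 : diagGL u v * (diagGL w z * onePlusP !![0, b; c, 0]) * (diagGL u v)⁻¹ =
        diagGL w z * (diagGL u v * onePlusP !![0, b; c, 0] * (diagGL u v)⁻¹) := by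
      rw [← mul_assoc, diagGL_commute]
      simp only [mul_assoc]
    rw [h2, conj_onePlusP, conjMap_diagGL, mul_inv_rev, mul_assoc, inv_mul_cancel_left,
      ← onePlusP_neg, ← onePlusP_add] at h1
    convert h1 using 2
    ext i j
    fin_cases i <;> fin_cases j <;> simp [hm, hn] <;> ring
  have iter : ∀ k : ℕ, onePlusP !![0, m ^ (k + 1) * b; n ^ (k + 1) * c, 0] ∈ H := by
    intro k
    induction k with
    | zero => simpa using step hx
    | succ k ih =>
      have h1 : diagGL 1 1 = (1 : GL (Fin 2) (ZMod (p ^ 2))) := by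
        apply Units.ext
        simp [Matrix.one_fin_two]
      have := step (w := 1) (z := 1) (by rw [h1, one_mul]; exact ih)
      rwa [← mul_assoc, ← mul_assoc, ← pow_succ' m (k + 1), ← pow_succ' n (k + 1)] at this
  have hm0 : m ≠ 0 := by
    rw [hm, ← div_eq_mul_inv, sub_ne_zero]
    exact fun h => hne ((div_eq_one_iff_eq hv).1 h)
  have hn0 : n ≠ 0 := by
    rw [hn, ← div_eq_mul_inv, sub_ne_zero]
    exact fun h => hne ((div_eq_one_iff_eq hu).1 h).symm
  have hp : p - 2 + 1 = p - 1 := by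
    have := (Fact.out : p.Prime).two_le
    omega
  have h := iter (p - 2)
  rw [hp, ZMod.pow_card_sub_one_eq_one hm0, ZMod.pow_card_sub_one_eq_one hn0, one_mul,
    one_mul] at h
  exact (H.mul_mem_cancel_right h).1 hx

theorem IsFramed.exists_mem {H : Subgroup (GL (Fin 2) (ZMod (p ^ 2)))} (hH : IsFramed H)
    {x : GL (Fin 2) (ZMod (p ^ 2))} (hx : x ∈ H) :
    ∃ (w z : (ZMod (p ^ 2))ˣ) (b c : ZMod p), diagGL w z ∈ H ∧
      onePlusP !![0, b; c, 0] ∈ H ∧ x = diagGL w z * onePlusP !![0, b; c, 0] := by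
  obtain ⟨w, z, b, c, rfl⟩ := exists_diagGL_mul_onePlusP (hH.1 x hx)
  have hd := hH.diagGL_mem hx
  exact ⟨w, z, b, c, hd, (H.mul_mem_cancel_left hd).1 hx, rfl⟩

theorem eq_or_swap_of_isConj_diagGL {w z w' z' : (ZMod (p ^ 2))ˣ}
    (hwz : redZMod p w ≠ redZMod p z) (h : IsConj (diagGL w z) (diagGL w' z')) :
    (w' = w ∧ z' = z) ∨ (w' = z ∧ z' = w) := by
  obtain ⟨g, hg⟩ := isConj_iff.1 h
  have hg' := congrArg Units.val hg
  rw [Units.val_mul, Units.val_mul] at hg'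
  have ht : (w' : ZMod (p ^ 2)) + z' = w + z := by
    have := congrArg Matrix.trace hg'
    rw [Matrix.trace_mul_comm, ← mul_assoc, Units.inv_mul, one_mul] at this
    simpa [Matrix.trace_fin_two] using this.symm
  have hd : (w' : ZMod (p ^ 2)) * z' = w * z := by
    have := congrArg Matrix.det hg'
    rw [Matrix.det_mul, mul_comm, ← Matrix.det_mul, ← mul_assoc, Units.inv_mul, one_mul] at this
    simpa [Matrix.det_fin_two] using this.symm
  have hprod : ((w' : ZMod (p ^ 2)) - w) * (w' - z) = 0 := by
    linear_combination (w' : ZMod (p ^ 2)) * ht - hd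
  by_cases h0 : redZMod p ((w' : ZMod (p ^ 2)) - z) = 0
  · right
    have h1 : redZMod p ((w' : ZMod (p ^ 2)) - w) ≠ 0 := by
      intro h1
      rw [map_sub, sub_eq_zero] at h0 h1
      exact hwz (h1.symm.trans h0)
    have h2 := (isUnit_of_redZMod_ne_zero h1).mul_right_eq_zero.1 hprod
    exact ⟨Units.ext (sub_eq_zero.1 h2), Units.ext (by linear_combination ht - h2)⟩
  · left
    have h2 := (isUnit_of_redZMod_ne_zero h0).mul_left_eq_zero.1 hprod
    exact ⟨Units.ext (sub_eq_zero.1 h2), Units.ext (by linear_combination ht - h2)⟩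

/-- A diagonal matrix with entries distinct modulo `p` is determined up to a swap by its conjugacy
class, which also contains the corresponding element of `H'` and its diagonal factor. -/
theorem LocallyConjugate.diagGL_mem_or {H H' : Subgroup (GL (Fin 2) (ZMod (p ^ 2)))}
    (h : LocallyConjugate H H') (hH' : IsFramed H') {w z : (ZMod (p ^ 2))ˣ}
    (hwz : redZMod p w ≠ redZMod p z) (hm : diagGL w z ∈ H) :
    diagGL w z ∈ H' ∨ diagGL z w ∈ H' := by
  obtain ⟨y, hy, hc⟩ := h.exists_mem hm
  obtain ⟨w', z', b, c, hd, -, rfl⟩ := hH'.exists_mem hy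
  have hne : redZMod p w' ≠ redZMod p z' := by
    intro he
    have hc' := (reductionModP p).map_isConj hc
    rw [map_mul, reductionModP_onePlusP, mul_one, reductionModP_diagGL, reductionModP_diagGL,
      redZMod_eq_of_map_eq.2 he] at hc'
    obtain ⟨g, hg⟩ := isConj_iff.1 hc'.symm
    rw [← diagGL_self_mul, mul_inv_cancel_right, diagGL_inj] at hg
    exact hwz (redZMod_eq_of_map_eq.1 (hg.1.symm.trans hg.2))
  obtain ⟨A, hA⟩ := exists_onePlusP_conj_eq_diagGL hne b c
  rcases eq_or_swap_of_isConj_diagGL hwz (hc.trans (isConj_iff.2 ⟨_, hA⟩)) with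
    ⟨rfl, rfl⟩ | ⟨rfl, rfl⟩
  · exact Or.inl hd
  · exact Or.inr hd

/-- For an element of `H` that is scalar modulo `p`, local conjugacy provides an element of `H'` with
the same reduction, and the `p`-th power depends only on the reduction. -/
theorem LocallyConjugate.diagGL_pow_mem {H H' : Subgroup (GL (Fin 2) (ZMod (p ^ 2)))}
    (h : LocallyConjugate H H') (hH' : IsFramed H') {w z : (ZMod (p ^ 2))ˣ}
    (hwz : redZMod p w = redZMod p z) (hm : diagGL w z ∈ H) : diagGL w z ^ p ∈ H' := by
  obtain ⟨y, hy, hc⟩ := h.exists_mem hm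
  obtain ⟨w', z', b, c, hd, -, rfl⟩ := hH'.exists_mem hy
  have hc' := (reductionModP p).map_isConj hc
  rw [map_mul, reductionModP_onePlusP, mul_one, reductionModP_diagGL w z,
    redZMod_eq_of_map_eq.2 hwz] at hc'
  obtain ⟨g, hg⟩ := isConj_iff.1 hc'
  rw [← diagGL_self_mul, mul_inv_cancel_right] at hg
  obtain ⟨A, hA⟩ := exists_onePlusP_eq (x := (diagGL w' z')⁻¹ * diagGL w z) (by
    rw [map_mul, map_inv, ← hg, reductionModP_diagGL, redZMod_eq_of_map_eq.2 hwz, inv_mul_cancel])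
  have hcomm : Commute (diagGL w' z')⁻¹ (diagGL w z) :=
    Commute.inv_left (diagGL_commute w' z' w z)
  have := onePlusP_pow_p A
  rw [hA, hcomm.mul_pow, inv_pow, inv_mul_eq_one] at this
  rw [← this]
  exact H'.pow_mem hd p

theorem LocallyConjugate.forall_diagGL_mem_or (hp : Odd p)
    {H H' : Subgroup (GL (Fin 2) (ZMod (p ^ 2)))} (h : LocallyConjugate H H') (hH : IsFramed H)
    (hH' : IsFramed H') :
    (∀ w z : (ZMod (p ^ 2))ˣ, diagGL w z ∈ H → diagGL w z ∈ H') ∨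
      (∀ w z : (ZMod (p ^ 2))ˣ, diagGL w z ∈ H → diagGL z w ∈ H') := by
  let D := H ⊓ cartanSplit (ZMod (p ^ 2))
  let B := H'.map (MulAut.conj (swapGL (ZMod (p ^ 2)))).toMonoidHom
  let Z := (Subgroup.center (GL (Fin 2) (ZMod p))).comap (reductionModP p)
  have hB : ∀ {w z : (ZMod (p ^ 2))ˣ}, diagGL w z ∈ B ↔ diagGL z w ∈ H' := diagGL_mem_map_swap
  have hZ : ∀ {w z : (ZMod (p ^ 2))ˣ}, diagGL w z ∈ Z ↔ redZMod p w = redZMod p z := by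
    intro w z
    rw [Subgroup.mem_comap, reductionModP_diagGL, ← redZMod_eq_of_map_eq]
    constructor
    · intro hc
      have := Subgroup.mem_center_iff.1 hc (swapGL _)
      rw [← mul_inv_eq_iff_eq_mul, swapGL_mul_diagGL, diagGL_inj] at this
      exact this.2
    · intro he
      rw [he]
      exact Subgroup.mem_center_iff.2 fun g => (diagGL_self_mul _ g).symm
  have hcov : ∀ x ∈ D, x ∈ H' ∨ x ∈ B ∨ x ∈ Z := by
    rintro x ⟨hx, hxc⟩
    obtain ⟨w, z, rfl⟩ := mem_cartanSplit_iff.1 hxc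
    rw [hB, hZ]
    by_cases he : redZMod p w = redZMod p z
    · exact Or.inr (Or.inr he)
    · exact (h.diagGL_mem_or hH' he hx).imp_right Or.inl
  have hDZ : ¬ D ≤ Z := by
    obtain ⟨-, w, z, hm, hne⟩ := hH
    exact fun hle => hne (hZ.1 (hle ⟨hm, diagGL_mem_cartanSplit w z⟩))
  rcases exists_of_le_union hcov hDZ with hle | hle | ⟨k, hkD, hkZ, hkA, hk2⟩
  · exact Or.inl fun w z hm => hle ⟨hm, diagGL_mem_cartanSplit w z⟩
  · exact Or.inr fun w z hm => hB.1 (hle ⟨hm, diagGL_mem_cartanSplit w z⟩)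
  · -- Both `k ^ p` and `k ^ 2` lie in `H'`, and `p` is odd.
    exfalso
    apply hkA
    obtain ⟨w, z, rfl⟩ := mem_cartanSplit_iff.1 hkD.2
    have hkp := h.diagGL_pow_mem hH' (hZ.1 hkZ) hkD.1
    obtain ⟨m, hm⟩ := hp
    have e : diagGL w z ^ p = (diagGL w z ^ 2) ^ m * diagGL w z := by
      rw [← pow_mul, ← pow_succ]
      exact congrArg _ hm
    rw [e] at hkp
    exact (H'.mul_mem_cancel_left (H'.pow_mem hk2 m)).1 hkp

theorem LocallyConjugate.forall_diagGL_mem_iff_or (hp : Odd p)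
    {H H' : Subgroup (GL (Fin 2) (ZMod (p ^ 2)))} (h : LocallyConjugate H H') (hH : IsFramed H)
    (hH' : IsFramed H') :
    (∀ w z : (ZMod (p ^ 2))ˣ, diagGL w z ∈ H ↔ diagGL w z ∈ H') ∨
      (∀ w z : (ZMod (p ^ 2))ˣ, diagGL w z ∈ H ↔ diagGL z w ∈ H') := by
  let U := (ZMod (p ^ 2))ˣ × (ZMod (p ^ 2))ˣ
  let S : Subgroup (GL (Fin 2) (ZMod (p ^ 2))) → Set U := fun H => {q | diagGL q.1 q.2 ∈ H}
  have hsw : ∀ H, (Prod.swap '' S H).ncard = (S H).ncard := fun H =>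
    Set.ncard_image_of_injective _ Prod.swap_injective
  have himg : ∀ H, Prod.swap '' S H = {q : U | diagGL q.2 q.1 ∈ H} := by
    intro H
    rw [Set.image_swap_eq_preimage_swap]
    rfl
  have card_le : ∀ {H H' : Subgroup (GL (Fin 2) (ZMod (p ^ 2)))}, LocallyConjugate H H' →
      IsFramed H → IsFramed H' → (S H).ncard ≤ (S H').ncard := by
    intro H H' h hH hH'
    rcases h.forall_diagGL_mem_or hp hH hH' with hle | hle
    · exact Set.ncard_le_ncard (fun q hq => hle _ _ hq) (Set.toFinite _)
    · rw [← hsw H', himg]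
      exact Set.ncard_le_ncard (fun q hq => hle _ _ hq) (Set.toFinite _)
  have hge := card_le h.symm hH' hH
  rcases h.forall_diagGL_mem_or hp hH hH' with hle | hle
  · left
    have := Set.eq_of_subset_of_ncard_le (s := S H) (t := S H') (fun q hq => hle _ _ hq) hge
      (Set.toFinite _)
    exact fun w z => Set.ext_iff.1 this (w, z)
  · right
    rw [← hsw H', himg] at hge
    have := Set.eq_of_subset_of_ncard_le (s := S H) (fun q hq => hle _ _ hq) hge (Set.toFinite _)
    exact fun w z => Set.ext_iff.1 this (w, z)

end Diagonalizable

/-! ### Antidiagonal parts -/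

section Lines

variable {K : Type*} [Field K]

/-- Every member of `V` has its diagonal and its antidiagonal part in `V`. -/
def IsSplitSub (V : Submodule K (Matrix (Fin 2) (Fin 2) K)) : Prop :=
  ∀ A ∈ V, !![A 0 0, 0; 0, A 1 1] ∈ V ∧ !![0, A 0 1; A 1 0, 0] ∈ V

theorem IsSplitSub.perp {V : Submodule K (Matrix (Fin 2) (Fin 2) K)} (hV : IsSplitSub V) :
    IsSplitSub ((trForm K).orthogonal V) := by
  refine fun A hA => ⟨mem_perp.2 fun X hX => ?_, mem_perp.2 fun X hX => ?_⟩
  · have := mem_perp.1 hA _ (hV X hX).1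
    simp only [Matrix.trace_fin_two, Matrix.mul_apply, Fin.sum_univ_two] at this ⊢
    simpa using this
  · have := mem_perp.1 hA _ (hV X hX).2
    simp only [Matrix.trace_fin_two, Matrix.mul_apply, Fin.sum_univ_two] at this ⊢
    simpa using this

theorem IsSplitSub.diag_mem_perp_iff {V : Submodule K (Matrix (Fin 2) (Fin 2) K)}
    (hV : IsSplitSub V) {a d : K} : !![a, 0; 0, d] ∈ (trForm K).orthogonal V ↔
      ∀ x y : K, !![x, 0; 0, y] ∈ V → x * a + y * d = 0 := by
  rw [mem_perp]
  constructor
  · intro h x y hxy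
    simpa [Matrix.trace_fin_two, Matrix.mul_apply, Fin.sum_univ_two] using h _ hxy
  · intro h X hX
    simpa [Matrix.trace_fin_two, Matrix.mul_apply, Fin.sum_univ_two] using h _ _ (hV X hX).1

theorem IsSplitSub.antidiag_mem_perp_iff {V : Submodule K (Matrix (Fin 2) (Fin 2) K)}
    (hV : IsSplitSub V) {b c : K} : !![0, b; c, 0] ∈ (trForm K).orthogonal V ↔
      ∀ x y : K, !![0, x; y, 0] ∈ V → x * c + y * b = 0 := by
  rw [mem_perp]
  constructor
  · intro h x y hxy
    simpa [Matrix.trace_fin_two, Matrix.mul_apply, Fin.sum_univ_two] using h _ hxy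
  · intro h X hX
    simpa [Matrix.trace_fin_two, Matrix.mul_apply, Fin.sum_univ_two] using h _ _ (hV X hX).2

/-- If `diag(1, -1)` is not in `W`, the traceless matrices of `W` form its antidiagonal line, and
determinants determine that line up to a square. -/
theorem exists_sq_of_diag_notMem {V W : Submodule K (Matrix (Fin 2) (Fin 2) K)}
    (h : LocConjSub V W) (hW : IsSplitSub W) (hdiag : !![1, 0; 0, -1] ∉ W) {a b a' b' : K}
    (hab : a ≠ 0 ∨ b ≠ 0) (hV' : !![0, a; b, 0] ∈ V)
    (hW' : ∀ x y : K, !![0, x; y, 0] ∈ W → ∃ t, x = t * a' ∧ y = t * b') :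
    ∃ t, t ≠ 0 ∧ a * b = t ^ 2 * (a' * b') := by
  obtain ⟨A, hA, hc⟩ := h.exists_mem hV'
  obtain ⟨h1, h2⟩ := hW A hA
  obtain ⟨t, ht1, ht2⟩ := hW' _ _ h2
  have htr : A 0 0 + A 1 1 = 0 := by
    have := hc.trace_eq
    simpa [Matrix.trace_fin_two] using this
  have h00 : A 0 0 = 0 := by
    by_contra hne
    apply hdiag
    convert W.smul_mem (A 0 0)⁻¹ h1 using 1
    rw [eq_neg_of_add_eq_zero_right htr]
    ext i j
    fin_cases i <;> fin_cases j <;> simp [hne]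
  have h11 : A 1 1 = 0 := by rw [h00, zero_add] at htr; exact htr
  refine ⟨t, ?_, ?_⟩
  · rintro rfl
    have hA0 : A = 0 := by
      ext i j
      fin_cases i <;> fin_cases j <;> simp [h00, h11, ht1, ht2]
    have h0 := hc.eq_zero_iff.1 hA0
    have e1 := congrFun (congrFun h0 0) 1
    have e2 := congrFun (congrFun h0 1) 0
    simp at e1 e2
    rcases hab with hab | hab <;> contradiction
  · have hd := hc.det_eq
    rw [Matrix.det_fin_two, Matrix.det_fin_two, h00, ht1, ht2] at hd
    simp at hd
    linear_combination -hd

/-- For locally conjugate spaces with antidiagonal parts spanned by `(a, b)` and `(a', b')`, the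
products `a b` and `a' b'` differ by a nonzero square. -/
theorem exists_sq_of_locConjSub [Finite K] (h2 : (2 : K) ≠ 0)
    {V W : Submodule K (Matrix (Fin 2) (Fin 2) K)} (h : LocConjSub V W) (hV : IsSplitSub V)
    (hW : IsSplitSub W)
    {a b a' b' : K} (hab : a ≠ 0 ∨ b ≠ 0) (hab' : a' ≠ 0 ∨ b' ≠ 0)
    (hV' : ∀ x y : K, !![0, x; y, 0] ∈ V ↔ ∃ t, x = t * a ∧ y = t * b)
    (hW' : ∀ x y : K, !![0, x; y, 0] ∈ W ↔ ∃ t, x = t * a' ∧ y = t * b') :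
    ∃ t, t ≠ 0 ∧ a * b = t ^ 2 * (a' * b') := by
  by_cases hdiag : !![1, 0; 0, -1] ∈ W
  · -- Pass to orthogonal complements, which do not contain `diag(1, -1)` and whose antidiagonal
    -- parts are spanned by `(a, -b)` and `(a', -b')`.
    obtain ⟨t, ht, he⟩ := exists_sq_of_diag_notMem (a := a) (b := -b) (a' := a') (b' := -b') h.perp
      hW.perp (by
        rw [hW.diag_mem_perp_iff]
        intro h0
        have := h0 _ _ hdiag
        apply h2
        linear_combination this)
      (hab.imp_right neg_ne_zero.2) (by
        rw [hV.antidiag_mem_perp_iff]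
        intro x y hxy
        obtain ⟨t, rfl, rfl⟩ := (hV' _ _).1 hxy
        ring) (by
        intro x y hxy
        rw [hW.antidiag_mem_perp_iff] at hxy
        have e := hxy a' b' ((hW' _ _).2 ⟨1, by simp⟩)
        rcases hab' with h0 | h0
        · refine ⟨x / a', by field_simp, ?_⟩
          field_simp
          linear_combination e
        · refine ⟨-y / b', ?_, ?_⟩
          · field_simp
            linear_combination e
          · field_simp)
    exact ⟨t, ht, by linear_combination -he⟩
  · exact exists_sq_of_diag_notMem h hW hdiag hab ((hV' _ _).2 ⟨1, by simp⟩)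
      fun x y hxy => (hW' x y).1 hxy

theorem exists_span_of_ne_bot_of_ne_top {U : Submodule K (K × K)} (hb : U ≠ ⊥) (ht : U ≠ ⊤) :
    ∃ a b : K, (a ≠ 0 ∨ b ≠ 0) ∧ ∀ x y : K, (x, y) ∈ U ↔ ∃ t, x = t * a ∧ y = t * b := by
  have h2 : Module.finrank K (K × K) = 2 := by simp
  have h0 : Module.finrank K U ≠ 0 := fun h => hb (Submodule.finrank_eq_zero.1 h)
  have hlt := Submodule.finrank_lt ht
  have h1 : Module.finrank K U = 1 := by omega
  obtain ⟨⟨⟨a, b⟩, hU⟩, hne, hspan⟩ := finrank_eq_one_iff'.1 h1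
  refine ⟨a, b, ?_, fun x y => ⟨fun hxy => ?_, ?_⟩⟩
  · by_contra! hab
    apply hne
    obtain ⟨rfl, rfl⟩ := hab
    rfl
  · obtain ⟨t, ht⟩ := hspan ⟨(x, y), hxy⟩
    have e : t • ((a, b) : K × K) = (x, y) := congrArg Subtype.val ht
    simp only [Prod.smul_mk, smul_eq_mul, Prod.mk.injEq] at e
    exact ⟨t, e.1.symm, e.2.symm⟩
  · rintro ⟨t, rfl, rfl⟩
    exact U.smul_mem t hU

/-- The antidiagonal matrices, parametrized by their entries. -/
def antidiagMap (K : Type*) [Field K] : K × K →ₗ[K] Matrix (Fin 2) (Fin 2) K where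
  toFun v := !![0, v.1; v.2, 0]
  map_add' v w := by
    ext i j
    fin_cases i <;> fin_cases j <;> simp
  map_smul' c v := by
    ext i j
    fin_cases i <;> fin_cases j <;> simp

end Lines

/-! ### Conclusion of the classification -/

section Conclusion

variable {p : ℕ} [Fact p.Prime]

theorem IsFramed.isSplitSub_kernelSub {H : Subgroup (GL (Fin 2) (ZMod (p ^ 2)))}
    (hH : IsFramed H) : IsSplitSub (kernelSub H) := by
  intro A hA
  have hsum : A = !![A 0 0, 0; 0, A 1 1] + !![0, A 0 1; A 1 0, 0] := by
    ext i j
    fin_cases i <;> fin_cases j <;> simp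
  obtain ⟨w, z, hwz⟩ := exists_diagGL_eq_onePlusP (A 0 0) (A 1 1)
  have hx : diagGL w z * onePlusP !![0, A 0 1; A 1 0, 0] ∈ H := by
    rw [← hwz, ← onePlusP_add, ← hsum]
    exact hA
  have hd := hH.diagGL_mem hx
  exact ⟨by rw [mem_kernelSub, hwz]; exact hd, (H.mul_mem_cancel_left hd).1 hx⟩

/-- Framed subgroups with the same diagonal matrices are compared through their antidiagonal
parts. -/
theorem IsFramed.le_of_antidiag {H H' : Subgroup (GL (Fin 2) (ZMod (p ^ 2)))} (hH : IsFramed H)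
    (hd : ∀ w z : (ZMod (p ^ 2))ˣ, diagGL w z ∈ H → diagGL w z ∈ H')
    (hU : ∀ b c : ZMod p, onePlusP !![0, b; c, 0] ∈ H → onePlusP !![0, b; c, 0] ∈ H') :
    H ≤ H' := by
  intro x hx
  obtain ⟨w, z, b, c, h1, h2, rfl⟩ := hH.exists_mem hx
  exact H'.mul_mem (hd _ _ h1) (hU _ _ h2)

theorem swapGL_conj (w z : (ZMod (p ^ 2))ˣ) (b c : ZMod p) :
    swapGL _ * (diagGL w z * onePlusP !![0, b; c, 0]) * (swapGL _)⁻¹ =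
      diagGL z w * onePlusP !![0, c; b, 0] := by
  rw [← conjMap_swapGL 0 b c 0, ← conj_onePlusP, ← swapGL_mul_diagGL w z]
  simp only [← mul_assoc, inv_mul_cancel_right]

theorem IsFramed.map_swap {H : Subgroup (GL (Fin 2) (ZMod (p ^ 2)))} (hH : IsFramed H) :
    IsFramed (H.map (MulAut.conj (swapGL (ZMod (p ^ 2)))).toMonoidHom) := by
  constructor
  · rintro _ ⟨x, hx, rfl⟩
    obtain ⟨w, z, b, c, -, -, rfl⟩ := hH.exists_mem hx
    change reductionModP p (swapGL _ * _ * (swapGL _)⁻¹) ∈ _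
    rw [swapGL_conj, map_mul, reductionModP_onePlusP, mul_one, reductionModP_diagGL]
    exact diagGL_mem_cartanSplit _ _
  · obtain ⟨-, w, z, hm, hne⟩ := hH
    exact ⟨z, w, diagGL_mem_map_swap.2 hm, hne.symm⟩

/-- If the antidiagonal parts are the two coordinate lines, the pair is exceptional. -/
theorem IsFramed.exceptionalPair {H H' : Subgroup (GL (Fin 2) (ZMod (p ^ 2)))}
    (hH : IsFramed H) (hH' : IsFramed H')
    (hd : ∀ w z : (ZMod (p ^ 2))ˣ, diagGL w z ∈ H ↔ diagGL w z ∈ H')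
    (hU : ∀ b c : ZMod p, onePlusP !![0, b; c, 0] ∈ H ↔ b = 0)
    (hU' : ∀ b c : ZMod p, onePlusP !![0, b; c, 0] ∈ H' ↔ c = 0) : ExceptionalPair H H' := by
  have h1 : diagGL 1 1 = (1 : GL (Fin 2) (ZMod (p ^ 2))) := by
    apply Units.ext
    simp [Matrix.one_fin_two]
  refine ⟨_, H', ⟨swapGL _, rfl⟩, ConjugateSubgroups.refl H', ⟨?_, ?_⟩, ⟨(hU' _ _).2 rfl, ?_⟩,
    fun w z => diagGL_mem_map_swap.trans (hd z w)⟩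
  · refine ⟨_, (hU 0 1).2 rfl, ?_⟩
    have := swapGL_conj (p := p) 1 1 0 1
    rwa [h1, one_mul, one_mul] at this
  · rintro _ ⟨x, hx, rfl⟩
    obtain ⟨w, z, b, c, -, h2, rfl⟩ := hH.exists_mem hx
    rw [hU] at h2
    subst h2
    exact ⟨z, w, c, swapGL_conj w z 0 c⟩
  · intro x hx
    obtain ⟨w, z, b, c, -, h2, rfl⟩ := hH'.exists_mem hx
    rw [hU'] at h2
    subst h2
    exact ⟨w, z, b, rfl⟩

theorem LocallyConjugate.conjugate_or_exceptional_of_diag_eq (h2 : (2 : ZMod p) ≠ 0)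
    {H H' : Subgroup (GL (Fin 2) (ZMod (p ^ 2)))} (h : LocallyConjugate H H') (hH : IsFramed H)
    (hH' : IsFramed H') (hd : ∀ w z : (ZMod (p ^ 2))ˣ, diagGL w z ∈ H ↔ diagGL w z ∈ H') :
    ConjugateSubgroups H H' ∨ ExceptionalPair H H' := by
  let U := (kernelSub H).comap (antidiagMap (ZMod p))
  let U' := (kernelSub H').comap (antidiagMap (ZMod p))
  have hle : (∀ b c : ZMod p, onePlusP !![0, b; c, 0] ∈ H → onePlusP !![0, b; c, 0] ∈ H') →
      ConjugateSubgroups H H' := fun hU =>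
    h.conjugateSubgroups_of_le (hH.le_of_antidiag (fun w z => (hd w z).1) hU)
  have hge : (∀ b c : ZMod p, onePlusP !![0, b; c, 0] ∈ H' → onePlusP !![0, b; c, 0] ∈ H) →
      ConjugateSubgroups H H' := fun hU =>
    (h.symm.conjugateSubgroups_of_le (hH'.le_of_antidiag (fun w z => (hd w z).2) hU)).symm
  have hleU : U ≤ U' → ConjugateSubgroups H H' := fun h0 =>
    hle fun b c hbc => h0 (x := (b, c)) hbc
  have hgeU : U' ≤ U → ConjugateSubgroups H H' := fun h0 =>
    hge fun b c hbc => h0 (x := (b, c)) hbc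
  by_cases hU0 : U = ⊥
  · exact Or.inl (hleU (hU0 ▸ bot_le))
  by_cases hU1 : U = ⊤
  · exact Or.inl (hgeU (hU1 ▸ le_top))
  by_cases hU0' : U' = ⊥
  · exact Or.inl (hgeU (hU0' ▸ bot_le))
  by_cases hU1' : U' = ⊤
  · exact Or.inl (hleU (hU1' ▸ le_top))
  obtain ⟨a, b, hab, hU⟩ := exists_span_of_ne_bot_of_ne_top hU0 hU1
  obtain ⟨a', b', hab', hU'⟩ := exists_span_of_ne_bot_of_ne_top hU0' hU1'
  have hm : ∀ x y : ZMod p, onePlusP !![0, x; y, 0] ∈ H ↔ ∃ t, x = t * a ∧ y = t * b := hU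
  have hm' : ∀ x y : ZMod p, onePlusP !![0, x; y, 0] ∈ H' ↔ ∃ t, x = t * a' ∧ y = t * b' := hU'
  obtain ⟨t, ht, he⟩ := exists_sq_of_locConjSub h2 h.locConjSub_kernelSub hH.isSplitSub_kernelSub
    hH'.isSplitSub_kernelSub hab hab' hm hm'
  -- The two lines are `{x = 0}` or `{y = 0}` if the products of coordinates vanish.
  have hx : ∀ {H : Subgroup (GL (Fin 2) (ZMod (p ^ 2)))} {a b : ZMod p}, (a ≠ 0 ∨ b ≠ 0) →
      (∀ x y : ZMod p, onePlusP !![0, x; y, 0] ∈ H ↔ ∃ t, x = t * a ∧ y = t * b) → a = 0 →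
      ∀ x y : ZMod p, onePlusP !![0, x; y, 0] ∈ H ↔ x = 0 := by
    rintro H a b hab hm rfl x y
    have hb : b ≠ 0 := by tauto
    rw [hm]
    exact ⟨fun ⟨t, ht, _⟩ => by rw [ht, mul_zero], fun h0 => ⟨y / b, by rw [h0, mul_zero],
      (div_mul_cancel₀ y hb).symm⟩⟩
  have hy : ∀ {H : Subgroup (GL (Fin 2) (ZMod (p ^ 2)))} {a b : ZMod p}, (a ≠ 0 ∨ b ≠ 0) →
      (∀ x y : ZMod p, onePlusP !![0, x; y, 0] ∈ H ↔ ∃ t, x = t * a ∧ y = t * b) → b = 0 →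
      ∀ x y : ZMod p, onePlusP !![0, x; y, 0] ∈ H ↔ y = 0 := by
    rintro H a b hab hm rfl x y
    have ha : a ≠ 0 := by tauto
    rw [hm]
    exact ⟨fun ⟨t, _, ht⟩ => by rw [ht, mul_zero], fun h0 => ⟨x / a,
      (div_mul_cancel₀ x ha).symm, by rw [h0, mul_zero]⟩⟩
  by_cases h0 : a * b = 0
  · have h0' : a' * b' = 0 := by
      rw [h0] at he
      exact (mul_eq_zero.1 he.symm).resolve_left (pow_ne_zero 2 ht)
    rcases mul_eq_zero.1 h0 with ha | hb <;> rcases mul_eq_zero.1 h0' with ha' | hb'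
    · exact Or.inl (hle fun x y h => (hx hab' hm' ha' x y).2 ((hx hab hm ha x y).1 h))
    · exact Or.inr (hH.exceptionalPair hH' hd (hx hab hm ha) (hy hab' hm' hb'))
    · exact Or.inr (hH'.exceptionalPair hH (fun w z => (hd w z).symm) (hx hab' hm' ha')
        (hy hab hm hb)).symm
    · exact Or.inl (hle fun x y h => (hy hab' hm' hb' x y).2 ((hy hab hm hb x y).1 h))
  · -- A diagonal matrix conjugates one line to the other, and centralizes diagonal matrices.
    left
    have ha : a ≠ 0 := left_ne_zero_of_mul h0
    have ha' : a' ≠ 0 := by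
      rintro rfl
      rw [zero_mul, mul_zero] at he
      exact h0 he
    obtain ⟨u, hu⟩ := exists_units_map_eq (Units.mk0 (t * a' / a) (by positivity))
    have hu' : redZMod p u = t * a' / a := congrArg Units.val hu
    refine h.conjugateSubgroups_of_forall_mem (diagGL u 1) fun x hx => ?_
    obtain ⟨w, z, x, y, hwz, hxy, rfl⟩ := hH.exists_mem hx
    rw [← mul_assoc, diagGL_commute, mul_assoc, mul_assoc, ← mul_assoc (diagGL u 1), conj_onePlusP,
      conjMap_diagGL]
    refine H'.mul_mem ((hd w z).1 hwz) ?_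
    obtain ⟨s, rfl, rfl⟩ := (hm _ _).1 hxy
    rw [hm', hu']
    refine ⟨s * t, ?_, ?_⟩
    · simp
      field_simp
    · simp
      field_simp
      linear_combination s * he

/-- Locally conjugate subgroups that are diagonal modulo `p` are conjugate or exceptional. -/
theorem LocallyConjugate.conjugate_or_exceptional (hp : Odd p)
    {H H' : Subgroup (GL (Fin 2) (ZMod (p ^ 2)))} (h : LocallyConjugate H H')
    (hH : ∀ x ∈ H, reductionModP p x ∈ cartanSplit (ZMod p))
    (hH' : ∀ x ∈ H', reductionModP p x ∈ cartanSplit (ZMod p)) :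
    ConjugateSubgroups H H' ∨ ExceptionalPair H H' := by
  have h2 : (2 : ZMod p) ≠ 0 := by
    have h3 : p ≠ 2 := by
      rintro rfl
      exact absurd hp (by decide)
    exact Ring.two_ne_zero (by rwa [ZMod.ringChar_zmod_n])
  have scalar_of : ∀ {H H' : Subgroup (GL (Fin 2) (ZMod (p ^ 2)))}, LocallyConjugate H H' →
      (∀ x ∈ H, ∃ u : (ZMod p)ˣ, reductionModP p x = diagGL u u) →
      ∀ x ∈ H', ∃ u : (ZMod p)ˣ, reductionModP p x = diagGL u u := by
    intro H H' h hs x hx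
    obtain ⟨y, hy, hc⟩ := h.symm.exists_mem hx
    obtain ⟨u, hu⟩ := hs y hy
    have hc' := ((reductionModP p).map_isConj hc).symm
    rw [hu] at hc'
    obtain ⟨g, hg⟩ := isConj_iff.1 hc'
    rw [← diagGL_self_mul, mul_inv_cancel_right] at hg
    exact ⟨u, hg.symm⟩
  by_cases hs : ∀ x ∈ H, ∃ u : (ZMod p)ˣ, reductionModP p x = diagGL u u
  · exact h.conjugate_or_exceptional_of_scalar h2 hs (scalar_of h hs)
  have hs' : ¬ ∀ x ∈ H', ∃ u : (ZMod p)ˣ, reductionModP p x = diagGL u u := fun hs' =>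
    hs (scalar_of h.symm hs')
  rw [not_forall₂] at hs hs'
  obtain ⟨x, hx, hns⟩ := hs
  obtain ⟨x', hx', hns'⟩ := hs'
  obtain ⟨J, hJ, hJf⟩ := exists_isFramed hH hx hns
  obtain ⟨J', hJ', hJf'⟩ := exists_isFramed hH' hx' hns'
  have hl := (hJ.symm.locallyConjugate.trans h).trans hJ'.locallyConjugate
  have finish : ∀ {I : Subgroup (GL (Fin 2) (ZMod (p ^ 2)))}, ConjugateSubgroups H' I →
      IsFramed I → (∀ w z : (ZMod (p ^ 2))ˣ, diagGL w z ∈ J ↔ diagGL w z ∈ I) →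
      ConjugateSubgroups H H' ∨ ExceptionalPair H H' := by
    intro I hI hIf hd
    have hl := (hJ.symm.locallyConjugate.trans h).trans hI.locallyConjugate
    rcases hl.conjugate_or_exceptional_of_diag_eq h2 hJf hIf hd with hc | he
    · exact Or.inl ((hJ.trans hc).trans hI.symm)
    · exact Or.inr (he.of_conj hJ hI)
  rcases hl.forall_diagGL_mem_iff_or hp hJf hJf' with hd | hd
  · exact finish hJ' hJf' hd
  · exact finish (hJ'.trans ⟨swapGL _, rfl⟩) hJf'.map_swap fun w z =>
      (hd w z).trans diagGL_mem_map_swap.symm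

/-- Conjugates of `⟨D, 1 + p E₁₂⟩` and `⟨D', 1 + p E₁₂⟩`, for distinct diagonal swaps `D`, `D'`. -/
theorem nontriviallyLocallyConjugate_of_swaps {H H' D D' : Subgroup (GL (Fin 2) (ZMod (p ^ 2)))}
    (hD : D ≤ cartanSplit (ZMod (p ^ 2))) (hD' : D' ≤ cartanSplit (ZMod (p ^ 2)))
    (hs : DiagonalSwaps D D') (hne : D ≠ D')
    (h : ConjugateSubgroups H (adjoinOnePlusE12p p D))
    (h' : ConjugateSubgroups H' (adjoinOnePlusE12p p D')) : NontriviallyLocallyConjugate H H' := by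
  rw [diagonalSwaps_iff hD hD'] at hs
  refine ⟨(h.locallyConjugate.trans (locallyConjugate_adjoin hD hD' hs)).trans
    h'.symm.locallyConjugate, fun hc => hne ?_⟩
  have hc' := (h.symm.trans hc).trans h'
  exact le_antisymm (le_of_conjugateSubgroups_adjoin hD hD' hc')
    (le_of_conjugateSubgroups_adjoin hD' hD hc'.symm)

end Conclusion

theorem mainTheorem2 (p : ℕ) [Fact p.Prime] (hp : Odd p)
    (H₁ H₂ : Subgroup (GL (Fin 2) (ZMod (p ^ 2))))
    (hH₁ : H₁.map (reductionModP p) ≤ cartanSplit (ZMod p))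
    (hH₂ : H₂.map (reductionModP p) ≤ cartanSplit (ZMod p)) :
    NontriviallyLocallyConjugate H₁ H₂ ↔
      ∃ D D' : Subgroup (GL (Fin 2) (ZMod (p ^ 2))),
        D ≤ cartanSplit (ZMod (p ^ 2)) ∧ D' ≤ cartanSplit (ZMod (p ^ 2)) ∧
        DiagonalSwaps D D' ∧ D ≠ D' ∧
        ((ConjugateSubgroups H₁ (adjoinOnePlusE12p p D) ∧
            ConjugateSubgroups H₂ (adjoinOnePlusE12p p D')) ∨
          (ConjugateSubgroups H₁ (adjoinOnePlusE12p p D') ∧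
            ConjugateSubgroups H₂ (adjoinOnePlusE12p p D))) := by
  constructor
  · rintro ⟨hl, hn⟩
    rcases hl.conjugate_or_exceptional hp (fun x hx => hH₁ ⟨x, hx, rfl⟩)
      (fun x hx => hH₂ ⟨x, hx, rfl⟩) with hc | ⟨J, J', hJ, hJ', ⟨hT, hU⟩, ⟨hT', hU'⟩, hd⟩
    · exact absurd hc hn
    have e := eq_adjoin_of_isUpperP hT hU
    have e' := eq_adjoin_of_isUpperP hT' hU'
    refine ⟨J ⊓ cartanSplit _, J' ⊓ cartanSplit _, inf_le_right, inf_le_right, ?_, ?_,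
      Or.inl ⟨e ▸ hJ, e' ▸ hJ'⟩⟩
    · rw [diagonalSwaps_iff inf_le_right inf_le_right]
      exact fun w z => and_congr (hd w z)
        (iff_of_true (diagGL_mem_cartanSplit w z) (diagGL_mem_cartanSplit z w))
    · intro he
      rw [he, ← e'] at e
      exact hn (hJ.trans (e ▸ hJ'.symm))
  · rintro ⟨D, D', hD, hD', hs, hne, ⟨h₁, h₂⟩ | ⟨h₁, h₂⟩⟩
    · exact nontriviallyLocallyConjugate_of_swaps hD hD' hs hne h₁ h₂
    · have hs' : DiagonalSwaps D' D := by
        rw [diagonalSwaps_iff hD' hD]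
        exact fun w z => ((diagonalSwaps_iff hD hD').1 hs z w).symm
      exact nontriviallyLocallyConjugate_of_swaps hD' hD hs' hne.symm h₁ h₂
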